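/- **Setting.** All graphs are finite, simple and undirected. A graph is connected if there is a path between any two of its vertices. A cut vertex of a graph $H$ is a vertex $v$ such that $H-v$ is not connected; $H$ is biconnected if it is connected and has no cut vertex. A biconnected component of $H$ is a subgraph $H[U]$, where $U$ is inclusion-maximal such that $H[U]$ is biconnected. The biconnected component tree of a connected graph $H$ has a node for each biconnected component and for each cut vertex of $H$, and an edge between a component $C$ and a cut vertex $v$ whenever $v$ occurs in $C$. A 3-connected separating pair of a biconnected graph $H$ is a pair $\{u,v\}$ of distinct vertices such that $H-\{u,v\}$ is not connected and there are three distinct paths between $u$ and $v$ in $H$ that pairwise share only the vertices $u,v$. Let $U\subseteq V(H)$ be an inclusion-maximal set of vertices such that, for every 3-connected separating pair $\{u,v\}$ of $H$, all vertices of $U\setminus\{u,v\}$ lie in the same connected component of $H-\{u,v\}$. The triconnected component associated with $U$ is $H[U]$ together with a (virtual) edge $uv$ for each 3-connected separating pair $\{u,v\}\subseteq U$ of $H$. The triconnected component tree of $H$ has a node for each triconnected component and for each 3-connected separating pair of $H$, and an edge between a component $C$ and a pair $\{u,v\}$ whenever $u$ and $v$ both occur in $C$. A dynamic program over graphs with vertex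 set $\{0,\dots,n-1\}$ has finitely many auxiliary relations over this domain. Initially the graph has no edges and the auxiliary relations are defined by first-order formulas. After each insertion or deletion of an edge $\{u,v\}$, every auxiliary relation is redefined by a first-order update formula (one for insertions and one for deletions) with parameters $u,v$, which is evaluated on the edge relation, the auxiliary relations before the change, and the arithmetic relations $\leq,+,\times$. The formulas do not depend on $n$. A query, which assigns to every graph a relation of fixed arity on its vertices, is in $\mathsf{DynFO}$ if some dynamic program has an auxiliary relation that equals the result of the query on the current graph for every $n$ and after every (possibly empty) sequence of edge insertions and deletions. Trees are represented by constant-length tuples of vertices. The biconnected component tree of a connected component is named by each vertex of that component; the triconnected component tree of a biconnected component $B$ is named by any two distinct vertices of $B$ (by $(a,a)$ if $B$ consists of the single vertex $a$). Each node of a tree is named by at least one $k$-tuple of vertices, for a constant $k$. Such a family of trees can be maintained in $\mathsf{DynFO}$ if, for some constant $k$ and some choice of the node names, the following relations (with the name of the tree as a further argument) are $\mathsf{DynFO}$ queries: which tuples name a node of the tree, which nodes are components, which tuples name the same node, which nodes are adjacent in the tree, which vertices occur in a node, and which pairs of vertices are edges of a component. No nodes are listed for tuples that do not name a tree. **Lemma.**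 For arbitrary graphs under insertions and deletions of edges, the following can be maintained in $\mathsf{DynFO}$: (i) the biconnected component trees of all connected components, and (ii) the triconnected component trees of all biconnected components. -/

import Mathlib

/-! ### Dynamic programs and the class DynFO (for graphs under edge changes) -/

/-- Relation symbols available to update formulas: the edge relation of the input graph, the
arithmetic relations `≤`, `+`, `×` on the domain, and the auxiliary relations. -/
inductive DynRel {r : ℕ} (ar : Fin r → ℕ) : ℕ → Type
  | edge : DynRel ar 2
  | le : DynRel ar 2
  | add : DynRel ar 3
  | mul : DynRel ar 3
  | aux (i : Fin r) : DynRel ar (ar i)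

/-- The relational first-order language of update formulas. -/
def dynLang {r : ℕ} (ar : Fin r → ℕ) : FirstOrder.Language.{0, 0} :=
  ⟨fun _ => Empty, DynRel ar⟩

/-- The structure with domain `{0, …, n - 1}`, edge relation of `G`, arithmetic relations
(restrictions of those of `ℕ`), and auxiliary relations `A`. -/
@[reducible]
def dynStructure {r : ℕ} (ar : Fin r → ℕ) {n : ℕ} (G : SimpleGraph (Fin n))
    (A : ∀ i : Fin r, Set (Fin (ar i) → Fin n)) : (dynLang ar).Structure (Fin n) where
  funMap := fun f _ => Empty.elim f
  RelMap := fun {_} R =>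
    match R with
    | .edge => fun x => G.Adj (x 0) (x 1)
    | .le => fun x => x 0 ≤ x 1
    | .add => fun x => (x 0 : ℕ) + (x 1 : ℕ) = (x 2 : ℕ)
    | .mul => fun x => (x 0 : ℕ) * (x 1 : ℕ) = (x 2 : ℕ)
    | .aux i => fun x => x ∈ A i

/-- A dynamic program: a finite auxiliary schema, first-order formulas that define the initial
auxiliary relations on the initial (edgeless) input graph, and for every auxiliary relation an
update formula for insertions and one for deletions. The two extra free variables of an update
formula are the end points of the changed edge. -/
structure DynProgram where
  numRel : ℕ
  arity : Fin numRel → ℕ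
  init : ∀ i, FirstOrder.Language.graph.Formula (Fin (arity i))
  ins : ∀ i, (dynLang arity).Formula (Fin (arity i) ⊕ Fin 2)
  del : ∀ i, (dynLang arity).Formula (Fin (arity i) ⊕ Fin 2)

/-- Insertion or deletion of one edge `{u, v}`. -/
inductive EdgeChange (n : ℕ) : Type
  | ins (u v : Fin n) (h : u ≠ v) : EdgeChange n
  | del (u v : Fin n) (h : u ≠ v) : EdgeChange n

/-- The graph after a change. Inserting a present edge or deleting an absent one has no effect. -/
def EdgeChange.apply {n : ℕ} (G : SimpleGraph (Fin n)) : EdgeChange n → SimpleGraph (Fin n)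
  | .ins u v _ => G ⊔ SimpleGraph.edge u v
  | .del u v _ => G.deleteEdges {s(u, v)}

namespace DynProgram

/-- A state: the current input graph and the current auxiliary relations. -/
structure State (P : DynProgram) (n : ℕ) where
  graph : SimpleGraph (Fin n)
  aux : ∀ i, Set (Fin (P.arity i) → Fin n)

/-- The initial state: the edgeless graph and the auxiliary relations defined on it. -/
def initState (P : DynProgram) (n : ℕ) : P.State n where
  graph := ⊥
  aux i := {x | @FirstOrder.Language.Formula.Realize FirstOrder.Language.graph (Fin n)
    (⊥ : SimpleGraph (Fin n)).structure _ (P.init i) x}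

/-- One change: all update formulas are evaluated simultaneously in the structure before the
change. -/
def step (P : DynProgram) {n : ℕ} (S : P.State n) (δ : EdgeChange n) : P.State n where
  graph := δ.apply S.graph
  aux i :=
    match δ with
    | .ins u v _ => {x | @FirstOrder.Language.Formula.Realize (dynLang P.arity) (Fin n)
        (dynStructure P.arity S.graph S.aux) _ (P.ins i) (Sum.elim x ![u, v])}
    | .del u v _ => {x | @FirstOrder.Language.Formula.Realize (dynLang P.arity) (Fin n)
        (dynStructure P.arity S.graph S.aux) _ (P.del i) (Sum.elim x ![u, v])}

/-- The state after a sequence of changes. -/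
def run (P : DynProgram) {n : ℕ} (α : List (EdgeChange n)) : P.State n :=
  α.foldl P.step (P.initState n)

end DynProgram

/-- A `k`-ary query on finite graphs. -/
abbrev GraphQuery (k : ℕ) : Type :=
  ∀ n : ℕ, SimpleGraph (Fin n) → Set (Fin k → Fin n)

/-- The query `Q` is in DynFO: some dynamic program has an auxiliary relation that, over every
finite domain and after every sequence of edge changes starting from the edgeless graph, equals the
result of `Q` on the current graph. -/
def InDynFO {k : ℕ} (Q : GraphQuery k) : Prop :=
  ∃ (P : DynProgram) (i : Fin P.numRel) (h : P.arity i = k),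
    ∀ (n : ℕ) (α : List (EdgeChange n)) (x : Fin k → Fin n),
      (x ∘ Fin.cast h) ∈ (P.run α).aux i ↔ x ∈ Q n (P.run α).graph

/-! ### Decomposition trees -/

/-- A simple graph whose vertex set is a subset of `α`. -/
abbrev GraphIn (α : Type) : Type := (⊤ : SimpleGraph α).Subgraph

/-- Nodes of a decomposition tree over the vertex set `V`: a component (which is a graph) or a
separating set. -/
inductive DecNode (V : Type) : Type
  | comp (K : GraphIn V) : DecNode V
  | sep (S : Set V) : DecNode V

namespace DecNode

variable {V : Type}

/-- The node is a component. -/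
def IsComp : DecNode V → Prop
  | comp _ => True
  | sep _ => False

/-- The vertices represented by a node. -/
def verts : DecNode V → Set V
  | comp K => K.verts
  | sep S => S

/-- The edges of the component represented by a component node. -/
def Link : DecNode V → V → V → Prop
  | comp K => K.Adj
  | sep _ => fun _ _ => False

end DecNode

section Trees

variable {V : Type}

/-- The graph with one node for each of the components `𝒞` and each of the separating sets `𝒮`, and
an edge between a component and a separating set whenever the latter occurs in the former. -/
def decompositionTree (𝒞 : Set (GraphIn V)) (𝒮 : Set (Set V)) : GraphIn (DecNode V) where
  verts := DecNode.comp '' 𝒞 ∪ DecNode.sep '' 𝒮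
  Adj s t := ∃ K ∈ 𝒞, ∃ S ∈ 𝒮, S ⊆ K.verts ∧
    ((s = .comp K ∧ t = .sep S) ∨ (s = .sep S ∧ t = .comp K))
  adj_sub := by
    rintro s t ⟨K, _, S, _, _, ⟨rfl, rfl⟩ | ⟨rfl, rfl⟩⟩ <;> simp
  edge_vert := by
    rintro s t ⟨K, hK, S, hS, _, ⟨rfl, rfl⟩ | ⟨rfl, rfl⟩⟩
    · exact Or.inl ⟨K, hK, rfl⟩
    · exact Or.inr ⟨S, hS, rfl⟩
  symm := ⟨by
    rintro s t ⟨K, hK, S, hS, h, h' | h'⟩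
    · exact ⟨K, hK, S, hS, h, Or.inr ⟨h'.2, h'.1⟩⟩
    · exact ⟨K, hK, S, hS, h, Or.inl ⟨h'.2, h'.1⟩⟩⟩

/-- `G[U]` is connected: there is a path between any two of its vertices. -/
def ConnOn (G : SimpleGraph V) (U : Set V) : Prop := (G.induce U).Preconnected

/-- `v` is a cut vertex of `G[W]`. -/
def IsCutVertexOn (G : SimpleGraph V) (W : Set V) (v : V) : Prop :=
  v ∈ W ∧ ¬ ConnOn G (W \ {v})

/-- `G[U]` is biconnected: it is connected and has no cut vertex. -/
def BiconnOn (G : SimpleGraph V) (U : Set V) : Prop :=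
  ConnOn G U ∧ ∀ v, ¬ IsCutVertexOn G U v

/-- `G[U]` is a biconnected component of `G[W]`. -/
def IsBiconnComp (G : SimpleGraph V) (W U : Set V) : Prop :=
  Maximal (fun X => X ⊆ W ∧ BiconnOn G X) U

/-- The induced subgraph `G[U]`. -/
def inducedGraph (G : SimpleGraph V) (U : Set V) : GraphIn V where
  verts := U
  Adj x y := x ∈ U ∧ y ∈ U ∧ G.Adj x y
  adj_sub h := h.2.2.ne
  edge_vert h := h.1
  symm := ⟨fun _ _ h => ⟨h.2.1, h.1, h.2.2.symm⟩⟩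

/-- The biconnected component tree of the connected graph `G[W]`. -/
def biTree (G : SimpleGraph V) (W : Set V) : GraphIn (DecNode V) :=
  decompositionTree {K | ∃ U, IsBiconnComp G W U ∧ K = inducedGraph G U}
    {S | ∃ v, IsCutVertexOn G W v ∧ S = {v}}

/-- `{u, v}` is a 3-connected separating pair of `G[B]`: its removal disconnects `G[B]`, and `G[B]`
has three distinct paths between `u` and `v` that pairwise share no vertices but `u` and `v`. -/
def IsThreeConnSepPair (G : SimpleGraph V) (B : Set V) (u v : V) : Prop :=
  u ∈ B ∧ v ∈ B ∧ u ≠ v ∧ ¬ ConnOn G (B \ {u, v}) ∧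
  ∃ p : Fin 3 → G.Path u v, Function.Injective p ∧
    (∀ i, ∀ x ∈ (p i).1.support, x ∈ B) ∧
    ∀ i j, i ≠ j → ∀ x, x ∈ (p i).1.support → x ∈ (p j).1.support → x = u ∨ x = v

theorem IsThreeConnSepPair.symm {G : SimpleGraph V} {B : Set V} {u v : V}
    (h : IsThreeConnSepPair G B u v) : IsThreeConnSepPair G B v u := by
  obtain ⟨hu, hv, hne, hsep, p, hinj, hB, hd⟩ := h
  refine ⟨hv, hu, hne.symm, by rwa [Set.pair_comm], fun i => (p i).reverse, ?_, ?_, ?_⟩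
  · intro i j hij
    apply hinj
    have h2 := congrArg SimpleGraph.Path.reverse hij
    simpa [SimpleGraph.Path.reverse] using h2
  · intro i x hx
    exact hB i x (by simpa using hx)
  · intro i j hij x hx hy
    exact (hd i j hij x (by simpa using hx) (by simpa using hy)).symm

/-- No 3-connected separating pair of `G[B]` separates two vertices of `U`: for every such pair
`{u, v}`, all vertices of `U \ {u, v}` lie in one connected component of `G[B] - {u, v}`. -/
def NotSeparated (G : SimpleGraph V) (B U : Set V) : Prop :=
  ∀ u v, IsThreeConnSepPair G B u v →
    ∀ x y : ↥(B \ {u, v}), x.1 ∈ U → y.1 ∈ U → (G.induce (B \ {u, v})).Reachable x y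

/-- `U` is the vertex set of a triconnected component of the biconnected graph `G[B]`. -/
def IsTriconnComp (G : SimpleGraph V) (B U : Set V) : Prop :=
  Maximal (fun X => X ⊆ B ∧ NotSeparated G B X) U

/-- The triconnected component with vertex set `U`: the graph `G[U]` together with the virtual
edges, one for each 3-connected separating pair of `G[B]` inside `U`. -/
def triconnGraph (G : SimpleGraph V) (B U : Set V) : GraphIn V where
  verts := U
  Adj x y := x ∈ U ∧ y ∈ U ∧ (G.Adj x y ∨ IsThreeConnSepPair G B x y)
  adj_sub h := h.2.2.elim (fun h' => h'.ne) (fun h' => h'.2.2.1)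
  edge_vert h := h.1
  symm := ⟨fun _ _ h => ⟨h.2.1, h.1, h.2.2.imp (fun h' => h'.symm) (fun h' => h'.symm)⟩⟩

/-- The triconnected component tree of the biconnected graph `G[B]`. -/
def triTree (G : SimpleGraph V) (B : Set V) : GraphIn (DecNode V) :=
  decompositionTree {K | ∃ U, IsTriconnComp G B U ∧ K = triconnGraph G B U}
    {S | ∃ u v, IsThreeConnSepPair G B u v ∧ S = {u, v}}

end Trees

/-! ### Maintaining decomposition trees -/

/-- A family of decomposition trees for every finite graph: `T G c t` says that the `p`-tuple `c` of
vertices of `G` is a name of the tree `t`. -/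
abbrev TreeFamily (p : ℕ) : Type :=
  ∀ {n : ℕ}, SimpleGraph (Fin n) → (Fin p → Fin n) → GraphIn (DecNode (Fin n)) → Prop

/-- The queries by which decomposition trees are stored as relations. Each tree is named by
`p`-tuples of vertices, and each of its nodes by `k`-tuples of vertices. -/
structure TreeCode (p k : ℕ) where
  /-- `(c, x)`: `x` is a name of a node of the tree with name `c` -/
  node : GraphQuery (p + k)
  /-- `(c, x)`: the node `x` is a component -/
  isComp : GraphQuery (p + k)
  /-- `(c, x, y)`: `x` and `y` are names of the same node -/
  same : GraphQuery (p + (k + k))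
  /-- `(c, x, y)`: there is a tree edge between the nodes `x` and `y` -/
  adj : GraphQuery (p + (k + k))
  /-- `(c, x, v)`: the vertex `v` occurs in the node `x` -/
  mem : GraphQuery (p + (k + 1))
  /-- `(c, x, u, v)`: the node `x` is a component and `uv` is an edge of it -/
  link : GraphQuery (p + (k + 2))

namespace TreeCode

variable {p k : ℕ}

/-- All queries of the code are in DynFO. -/
def AllInDynFO (C : TreeCode p k) : Prop :=
  InDynFO C.node ∧ InDynFO C.isComp ∧ InDynFO C.same ∧ InDynFO C.adj ∧ InDynFO C.mem ∧
    InDynFO C.link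

/-- On the graph `G` and the name `c`, the queries describe the decomposition tree `t`: there is a
map `ν` from `k`-tuples to nodes, onto the nodes of `t`, under which the queries have their intended
meaning. -/
def Describes (C : TreeCode p k) {n : ℕ} (G : SimpleGraph (Fin n)) (c : Fin p → Fin n)
    (t : GraphIn (DecNode (Fin n))) : Prop :=
  ∃ ν : (Fin k → Fin n) → DecNode (Fin n),
    ν '' {x | Fin.append c x ∈ C.node n G} = t.verts ∧
    ∀ x, Fin.append c x ∈ C.node n G →
      (Fin.append c x ∈ C.isComp n G ↔ (ν x).IsComp) ∧
      (∀ v, Fin.append c (Fin.append x ![v]) ∈ C.mem n G ↔ v ∈ (ν x).verts) ∧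
      (∀ u v, Fin.append c (Fin.append x ![u, v]) ∈ C.link n G ↔ (ν x).Link u v) ∧
      ∀ y, Fin.append c y ∈ C.node n G →
        (Fin.append c (Fin.append x y) ∈ C.same n G ↔ ν x = ν y) ∧
        (Fin.append c (Fin.append x y) ∈ C.adj n G ↔ t.Adj (ν x) (ν y))

end TreeCode

/-- The trees of the family `T` can be maintained in DynFO: DynFO queries describe, on every graph,
all trees of the family, and yield no nodes for tuples that do not name a tree. -/
def TreesInDynFO {p : ℕ} (T : TreeFamily p) : Prop :=
  ∃ (k : ℕ) (C : TreeCode p k), C.AllInDynFO ∧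
    ∀ (n : ℕ) (G : SimpleGraph (Fin n)) (c : Fin p → Fin n),
      (∀ t, T G c t → C.Describes G c t) ∧
      ((∃ x, Fin.append c x ∈ C.node n G) → ∃ t, T G c t)

/-- The biconnected component trees of the connected components of a graph; the tree of a connected
component is named by each vertex of that component. -/
def biTrees : TreeFamily 1 :=
  fun G c t => t = biTree G (G.connectedComponentMk (c 0)).supp

/-- The triconnected component trees of the biconnected components of a graph; the tree of a
biconnected component `B` is named by any two distinct vertices of `B` (if `B = {a}`, by `(a, a)`);
distinct biconnected components share at most one vertex. -/
def triTrees : TreeFamily 2 :=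
  fun G c t => ∃ B, IsBiconnComp G Set.univ B ∧ c 0 ∈ B ∧ c 1 ∈ B ∧
    (c 0 ≠ c 1 ∨ B = {c 0}) ∧ t = triTree G B

/-! The only information that has to be maintained is reachability in `G` after the removal of two
vertices. For all `a`, `b` the program stores a spanning forest of `avoidGraph G a b` through the
relation `forestRel`: `x` and `y` are connected in the forest without the edge `uv`. This relation
yields reachability (take `u = v`) and the forest edges, and it has first-order updates. An inserted
edge either closes a cycle and is ignored, or joins two trees. A deleted forest edge splits a tree,
and the lexicographically first remaining edge between the two parts reconnects it; the linear order
makes this choice definable. Hence every query that is first-order in adjacency and in `WalkIn G {a,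
b}ᶜ` is in DynFO (`FOQ.inDynFO`).

It remains to define both kinds of trees in this logic. A biconnected component with two distinct
vertices `x`, `y` is the set `block G x y` of vertices that no single vertex separates from the pair
(`isBiconnComp_univ_iff_of_ne`). For triconnected components, the obstacle is the existence of three
disjoint paths. For a pair `u`, `v` that already separates a biconnected component, this is
equivalent to `u`, `v` being adjacent or not being separated by any `a`, `b` other than `u`, `v`
(`IsBiconnComp.hasThreePaths_iff`). The proof needs Menger's theorem only for two paths, inside one
component of `G[B] - {u, v}` (`TwoConnected.twoLinked`). A triconnected component is determined by
at most three of its vertices, because a separating pair cannot contain three distinct vertices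
(`IsBiconnComp.isTriconnComp_iff`).

Finally, `treesInDynFO_of_foq` derives equality and adjacency of nodes from their kinds and vertex
sets. -/

/-! ### Uniform first-order definability over a family of structures -/

section UniformDefinability

variable {ι : Type} {L : FirstOrder.Language.{0, 0}} {N : ι → ℕ}

/-- The family of relations `R` is defined by a single first-order formula over all structures of
the family `str`. -/
def UDef (str : ∀ i, L.Structure (Fin (N i))) {α : Type}
    (R : ∀ i, (α → Fin (N i)) → Prop) : Prop :=
  ∃ φ : L.Formula α, ∀ i x, @FirstOrder.Language.Formula.Realize L (Fin (N i)) (str i) α φ x ↔ R i x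

variable {str : ∀ i, L.Structure (Fin (N i))} {α β : Type}

namespace UDef

theorem congr {R R' : ∀ i, (α → Fin (N i)) → Prop} (h : UDef str R) (e : ∀ i x, R i x ↔ R' i x) :
    UDef str R' := by
  obtain ⟨φ, hφ⟩ := h
  exact ⟨φ, fun i x => (hφ i x).trans (e i x)⟩

theorem comp {R : ∀ i, (α → Fin (N i)) → Prop} (h : UDef str R) (f : α → β) :
    UDef str (fun i (x : β → Fin (N i)) => R i (fun a => x (f a))) := by
  obtain ⟨φ, hφ⟩ := h
  refine ⟨φ.relabel f, fun i x => ?_⟩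
  let := str i
  rw [FirstOrder.Language.Formula.realize_relabel]
  exact hφ i _

theorem eq (a b : α) : UDef str (fun i (x : α → Fin (N i)) => x a = x b) :=
  ⟨(FirstOrder.Language.Term.var a).equal (FirstOrder.Language.Term.var b), fun i x => by
    let := str i
    simp [FirstOrder.Language.Formula.realize_equal]⟩

theorem rel {k : ℕ} (r : L.Relations k) (t : Fin k → α) :
    UDef str (fun i (x : α → Fin (N i)) => (str i).RelMap r (fun j => x (t j))) :=
  ⟨FirstOrder.Language.Relations.formula r (fun j => FirstOrder.Language.Term.var (t j)),
    fun i x => by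
    let := str i
    rw [FirstOrder.Language.Formula.realize_rel]
    rfl⟩

theorem false : UDef str (fun i (_ : α → Fin (N i)) => False) :=
  ⟨⊥, fun _ _ => Iff.rfl⟩

theorem not {R : ∀ i, (α → Fin (N i)) → Prop} (h : UDef str R) :
    UDef str (fun i x => ¬ R i x) := by
  obtain ⟨φ, hφ⟩ := h
  refine ⟨φ.not, fun i x => ?_⟩
  let := str i
  rw [FirstOrder.Language.Formula.realize_not]
  exact not_congr (hφ i x)

theorem and {R R' : ∀ i, (α → Fin (N i)) → Prop} (h : UDef str R) (h' : UDef str R') :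
    UDef str (fun i x => R i x ∧ R' i x) := by
  obtain ⟨φ, hφ⟩ := h
  obtain ⟨φ', hφ'⟩ := h'
  refine ⟨φ ⊓ φ', fun i x => ?_⟩
  let := str i
  rw [FirstOrder.Language.Formula.realize_inf]
  exact and_congr (hφ i x) (hφ' i x)

theorem or {R R' : ∀ i, (α → Fin (N i)) → Prop} (h : UDef str R) (h' : UDef str R') :
    UDef str (fun i x => R i x ∨ R' i x) :=
  (h.not.and h'.not).not.congr fun _ _ => by tauto

theorem imp {R R' : ∀ i, (α → Fin (N i)) → Prop} (h : UDef str R) (h' : UDef str R') :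
    UDef str (fun i x => R i x → R' i x) :=
  (h.and h'.not).not.congr fun _ _ => by tauto

theorem ne (a b : α) : UDef str (fun i (x : α → Fin (N i)) => x a ≠ x b) := (UDef.eq a b).not

theorem ne_and_ne (a b c : α) :
    UDef str (fun i (x : α → Fin (N i)) => x c ≠ x a ∧ x c ≠ x b) :=
  (UDef.ne c a).and (UDef.ne c b)

/-- The quantified variable is the extra element `none` of `Option α`, so the hypothesis is again an
instance of `UDef` and definitions can be built compositionally. -/
theorem ex {R : ∀ i, (α → Fin (N i)) → Fin (N i) → Prop}
    (h : UDef str (fun i (x : Option α → Fin (N i)) => R i (fun a => x (some a)) (x none))) :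
    UDef str (fun i x => ∃ a, R i x a) := by
  obtain ⟨φ, hφ⟩ := h
  let g : Option α → α ⊕ Fin 1 := fun o => o.elim (Sum.inr 0) Sum.inl
  refine ⟨(FirstOrder.Language.BoundedFormula.relabel (n := 1) g φ).ex, fun i x => ?_⟩
  let := str i
  rw [FirstOrder.Language.Formula.Realize, FirstOrder.Language.BoundedFormula.realize_ex]
  refine exists_congr fun a => ?_
  rw [FirstOrder.Language.BoundedFormula.realize_relabel]
  have e := hφ i (fun o => o.elim a x)
  refine Iff.trans ?_ e
  rw [FirstOrder.Language.Formula.Realize]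
  have h1 : (Sum.elim x (Fin.snoc default a ∘ Fin.castAdd 0) ∘ g : Option α → Fin (N i))
      = fun o => o.elim a x := by
    funext o
    cases o with
    | none => simp [g, Fin.snoc]
    | some o => simp [g]
  rw [h1]
  exact iff_of_eq (congrArg _ (Subsingleton.elim _ _))

theorem all {R : ∀ i, (α → Fin (N i)) → Fin (N i) → Prop}
    (h : UDef str (fun i (x : Option α → Fin (N i)) => R i (fun a => x (some a)) (x none))) :
    UDef str (fun i x => ∀ a, R i x a) :=
  (UDef.ex (R := fun i x a => ¬ R i x a) h.not).not.congr fun _ _ => by simp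

end UDef

end UniformDefinability

/-! ### Queries that are first-order in adjacency and avoiding reachability -/

/-- `x` and `y` are connected by a walk of `G` inside `U`. -/
def WalkIn {V : Type} (G : SimpleGraph V) (U : Set V) (x y : V) : Prop :=
  ∃ p : G.Walk x y, ∀ w ∈ p.support, w ∈ U

/-- Queries (with variables from `α`) that are first-order definable from the adjacency relation and
the relation "there is a walk between `x` and `y` that avoids `a` and `b`". -/
inductive FOQ : ∀ {α : Type}, (∀ n, SimpleGraph (Fin n) → (α → Fin n) → Prop) → Prop
  | congr {α : Type} {Q Q' : ∀ n, SimpleGraph (Fin n) → (α → Fin n) → Prop} :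
      FOQ Q → (∀ n G x, Q n G x ↔ Q' n G x) → FOQ Q'
  | eq {α : Type} (a b : α) : FOQ (fun n _ (x : α → Fin n) => x a = x b)
  | adj {α : Type} (a b : α) : FOQ (fun n G (x : α → Fin n) => G.Adj (x a) (x b))
  | avoid {α : Type} (a b c d : α) :
      FOQ (fun n G (x : α → Fin n) => WalkIn G {x a, x b}ᶜ (x c) (x d))
  | not {α : Type} {Q : ∀ n, SimpleGraph (Fin n) → (α → Fin n) → Prop} :
      FOQ Q → FOQ (fun n G x => ¬ Q n G x)
  | and {α : Type} {Q Q' : ∀ n, SimpleGraph (Fin n) → (α → Fin n) → Prop} :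
      FOQ Q → FOQ Q' → FOQ (fun n G x => Q n G x ∧ Q' n G x)
  | ex {α : Type} {Q : ∀ n, SimpleGraph (Fin n) → (α → Fin n) → Fin n → Prop} :
      FOQ (fun n G (x : Option α → Fin n) => Q n G (fun a => x (some a)) (x none)) →
        FOQ (fun n G x => ∃ a, Q n G x a)

namespace FOQ

variable {α : Type} {Q Q' : ∀ n, SimpleGraph (Fin n) → (α → Fin n) → Prop}

theorem or (h : FOQ Q) (h' : FOQ Q') : FOQ (fun n G x => Q n G x ∨ Q' n G x) :=
  (h.not.and h'.not).not.congr fun _ _ _ => by tauto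

theorem imp (h : FOQ Q) (h' : FOQ Q') : FOQ (fun n G x => Q n G x → Q' n G x) :=
  (h.and h'.not).not.congr fun _ _ _ => by tauto

theorem iff (h : FOQ Q) (h' : FOQ Q') : FOQ (fun n G x => Q n G x ↔ Q' n G x) :=
  ((h.imp h').and (h'.imp h)).congr fun _ _ _ => by tauto

theorem ne (a b : α) : FOQ (fun n _ (x : α → Fin n) => x a ≠ x b) := (FOQ.eq a b).not

theorem all {Q : ∀ n, SimpleGraph (Fin n) → (α → Fin n) → Fin n → Prop}
    (h : FOQ (fun n G (x : Option α → Fin n) => Q n G (fun a => x (some a)) (x none))) :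
    FOQ (fun n G x => ∀ a, Q n G x a) :=
  (FOQ.ex (Q := fun n G x a => ¬ Q n G x a) h.not).not.congr fun _ _ _ => by simp

/-- A first-order query on a graph that depends on parameters is uniformly definable as soon as
adjacency and avoiding reachability in this graph are. -/
theorem uDef {ι : Type} {L : FirstOrder.Language.{0, 0}} {N : ι → ℕ}
    {str : ∀ i, L.Structure (Fin (N i))}
    {β : Type} (H : ∀ i, (β → Fin (N i)) → SimpleGraph (Fin (N i)))
    (hadj : UDef str (fun i (x : Fin 2 ⊕ β → Fin (N i)) =>
      (H i (fun b => x (.inr b))).Adj (x (.inl 0)) (x (.inl 1))))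
    (havoid : UDef str (fun i (x : Fin 4 ⊕ β → Fin (N i)) =>
      WalkIn (H i (fun b => x (.inr b))) {x (.inl 0), x (.inl 1)}ᶜ (x (.inl 2)) (x (.inl 3))))
    (h : FOQ Q) :
    UDef str (fun i (x : α ⊕ β → Fin (N i)) =>
      Q (N i) (H i (fun b => x (.inr b))) (fun a => x (.inl a))) := by
  induction h with
  | congr _ e ih => exact ih.congr fun _ _ => e _ _ _
  | eq a b => exact UDef.eq _ _
  | adj a b => exact hadj.comp (Sum.map ![a, b] id)
  | avoid a b c d => exact havoid.comp (Sum.map ![a, b, c, d] id)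
  | not _ ih => exact ih.not
  | and _ _ ih ih' => exact ih.and ih'
  | ex _ ih =>
    -- The induction hypothesis has its variables in `Option α ⊕ β`, whereas `UDef.ex` expects
    -- `Option (α ⊕ β)`.
    exact UDef.ex (ih.comp (Sum.elim (fun o : Option _ => o.elim none (fun a => some (Sum.inl a)))
      (fun b => some (Sum.inr b))))

end FOQ

/-! ### Spanning forests under edge changes -/

section Forest

variable {V : Type}

/-- `x` and `y` are connected in `F` without the edge `uv`. -/
def forestRel (F : SimpleGraph V) (x y u v : V) : Prop := (F.deleteEdges {s(u, v)}).Reachable x y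

/-- The effect on `forestRel` of adding the edge `ab`. -/
def addEdgeRel (S : V → V → V → V → Prop) (a b x y u v : V) : Prop :=
  S x y u v ∨ (¬ (u = a ∧ v = b ∨ u = b ∧ v = a) ∧ (S x a u v ∧ S b y u v ∨ S x b u v ∧ S a y u v))

/-- `F` is a spanning forest of `H`. -/
structure IsSpanningForest (F H : SimpleGraph V) : Prop where
  le : F ≤ H
  acyclic : F.IsAcyclic
  spanning : ∀ x y, H.Reachable x y → F.Reachable x y

/-- Repeated passages through the new edge can be short-cut, so a single passage in one of the two
directions suffices. -/
theorem reachable_sup_edge_iff {K : SimpleGraph V} {a b x y : V} :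
    (K ⊔ SimpleGraph.edge a b).Reachable x y ↔ K.Reachable x y ∨
      K.Reachable x a ∧ K.Reachable b y ∨ K.Reachable x b ∧ K.Reachable a y := by
  constructor
  · rintro ⟨p⟩
    induction p with
    | nil => exact Or.inl .rfl
    | cons h p ih =>
      rcases h with h | h
      · have h' := h.reachable
        rcases ih with ih | ⟨ih, ih'⟩ | ⟨ih, ih'⟩
        · exact Or.inl (h'.trans ih)
        · exact Or.inr (Or.inl ⟨h'.trans ih, ih'⟩)
        · exact Or.inr (Or.inr ⟨h'.trans ih, ih'⟩)
      · rw [SimpleGraph.edge_adj] at h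
        rcases h with ⟨⟨rfl, rfl⟩ | ⟨rfl, rfl⟩, _⟩
        · rcases ih with ih | ⟨ih, ih'⟩ | ⟨ih, ih'⟩
          · exact Or.inr (Or.inl ⟨.rfl, ih⟩)
          · exact Or.inr (Or.inl ⟨.rfl, ih'⟩)
          · exact Or.inl ih'
        · rcases ih with ih | ⟨ih, ih'⟩ | ⟨ih, ih'⟩
          · exact Or.inr (Or.inr ⟨.rfl, ih⟩)
          · exact Or.inl ih'
          · exact Or.inr (Or.inr ⟨.rfl, ih'⟩)
  · have hm : ∀ {p q : V}, K.Reachable p q → (K ⊔ SimpleGraph.edge a b).Reachable p q :=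
      fun h => h.mono le_sup_left
    have hab : (K ⊔ SimpleGraph.edge a b).Reachable a b := by
      by_cases h : a = b
      · rw [h]
      · exact SimpleGraph.Adj.reachable (Or.inr (by simp [SimpleGraph.edge_adj, h]))
    rintro (h | ⟨h, h'⟩ | ⟨h, h'⟩)
    · exact hm h
    · exact (hm h).trans (hab.trans (hm h'))
    · exact (hm h).trans (hab.symm.trans (hm h'))

theorem deleteEdges_diag (F : SimpleGraph V) (a : V) : F.deleteEdges {s(a, a)} = F := by
  ext x y
  simp only [SimpleGraph.deleteEdges_adj, Set.mem_singleton_iff, Sym2.eq_iff]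
  grind [SimpleGraph.Adj.ne]

/-- A loop is never an edge, so the diagonal of the last two arguments records plain reachability
and no separate relation is needed for it. -/
theorem forestRel_diag {F : SimpleGraph V} {x y a : V} :
    forestRel F x y a a ↔ F.Reachable x y := by
  rw [forestRel, deleteEdges_diag]

theorem forestRel_sup_edge {F : SimpleGraph V} {a b x y u v : V} :
    forestRel (F ⊔ SimpleGraph.edge a b) x y u v ↔ addEdgeRel (forestRel F) a b x y u v := by
  unfold addEdgeRel
  by_cases h : u = a ∧ v = b ∨ u = b ∧ v = a
  -- Here `uv` is the new edge itself, and its deletion undoes the insertion.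
  · have e : (F ⊔ SimpleGraph.edge a b).deleteEdges {s(u, v)} = F.deleteEdges {s(u, v)} := by
      ext x y
      simp only [SimpleGraph.deleteEdges_adj, SimpleGraph.sup_adj, SimpleGraph.edge_adj,
        Set.mem_singleton_iff, Sym2.eq_iff]
      grind
    simp only [forestRel, e, h, not_true, false_and, or_false]
  · have e : (F ⊔ SimpleGraph.edge a b).deleteEdges {s(u, v)} =
        F.deleteEdges {s(u, v)} ⊔ SimpleGraph.edge a b := by
      ext x y
      simp only [SimpleGraph.deleteEdges_adj, SimpleGraph.sup_adj, SimpleGraph.edge_adj,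
        Set.mem_singleton_iff, Sym2.eq_iff]
      grind
    simp only [forestRel, e, h, not_false_eq_true, true_and, reachable_sup_edge_iff]

/-- The path between two vertices of a forest is unique: if some path avoids `uv` and some path
avoids `ab`, then it is one path that avoids both. This fails in graphs with cycles. -/
theorem forestRel_deleteEdges {F : SimpleGraph V} (hF : F.IsAcyclic) {a b x y u v : V} :
    forestRel (F.deleteEdges {s(a, b)}) x y u v ↔ forestRel F x y u v ∧ forestRel F x y a b := by
  classical
  have key : ∀ {c d x y}, forestRel F x y c d ↔ ∃ p : F.Path x y, s(c, d) ∉ p.1.edges := by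
    intro c d x y
    rw [forestRel, SimpleGraph.reachable_deleteEdges_iff_exists_walk]
    exact ⟨fun ⟨p, hp⟩ => ⟨p.toPath, fun h => hp (p.edges_bypass_subset_edges h)⟩,
      fun ⟨p, hp⟩ => ⟨p.1, hp⟩⟩
  constructor
  · intro h
    rw [forestRel] at h
    constructor
    · refine h.mono ?_
      exact SimpleGraph.deleteEdges_mono (SimpleGraph.deleteEdges_le _)
    · exact h.mono (SimpleGraph.deleteEdges_le _)
  · rw [key, key]
    rintro ⟨⟨p, hp⟩, q, hq⟩
    obtain rfl := (hF.subsingleton_path x y).elim p q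
    rw [forestRel, SimpleGraph.deleteEdges_deleteEdges]
    refine ⟨p.1.toDeleteEdges _ ?_⟩
    rintro e he (rfl | rfl)
    · exact hq he
    · exact hp he

/-- Every edge of a forest is a bridge. The forest edges can therefore be recovered from `forestRel`
alone. -/
theorem forest_adj_iff {F : SimpleGraph V} (hF : F.IsAcyclic) {a b : V} :
    F.Adj a b ↔ forestRel F a b a a ∧ ¬ forestRel F a b a b := by
  rw [forestRel_diag]
  constructor
  · intro h
    exact ⟨h.reachable, SimpleGraph.isBridge_iff.1
      (SimpleGraph.isAcyclic_iff_forall_adj_isBridge.1 hF h)⟩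
  · rintro ⟨h, h'⟩
    by_contra hab
    refine h' ?_
    have e : F.deleteEdges {s(a, b)} = F := by
      ext x y
      simp only [SimpleGraph.deleteEdges_adj, Set.mem_singleton_iff, Sym2.eq_iff]
      grind [SimpleGraph.Adj.symm]
    rwa [forestRel, e]

/-- The update of `forestRel` on the insertion of the edge `ab`. -/
def insertRel (S : V → V → V → V → Prop) (a b x y u v : V) : Prop :=
  S a b a a ∧ S x y u v ∨ ¬ S a b a a ∧ addEdgeRel S a b x y u v

theorem IsSpanningForest.exists_insert {F H : SimpleGraph V} (h : IsSpanningForest F H)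
    (a b : V) : ∃ F', IsSpanningForest F' (H ⊔ SimpleGraph.edge a b) ∧
      ∀ x y u v, forestRel F' x y u v ↔ insertRel (forestRel F) a b x y u v := by
  by_cases hr : F.Reachable a b
  · refine ⟨F, ⟨h.le.trans le_sup_left, h.acyclic, fun x y hxy => ?_⟩, fun x y u v => ?_⟩
    · rcases reachable_sup_edge_iff.1 hxy with h1 | ⟨h1, h2⟩ | ⟨h1, h2⟩
      · exact h.spanning _ _ h1
      · exact (h.spanning _ _ h1).trans (hr.trans (h.spanning _ _ h2))
      · exact (h.spanning _ _ h1).trans (hr.symm.trans (h.spanning _ _ h2))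
    · simp [insertRel, forestRel_diag, hr]
  · refine ⟨F ⊔ SimpleGraph.edge a b, ⟨sup_le_sup_right h.le _,
      h.acyclic.sup_edge_of_not_reachable hr, fun x y hxy => ?_⟩, fun x y u v => ?_⟩
    · rw [reachable_sup_edge_iff] at hxy ⊢
      exact hxy.imp (h.spanning _ _) (Or.imp (And.imp (h.spanning _ _) (h.spanning _ _))
        (And.imp (h.spanning _ _) (h.spanning _ _)))
    · simp [insertRel, forestRel_diag, hr, forestRel_sup_edge]

variable [LinearOrder V]

/-- `cd` is the first edge of `A` between the two parts into which the removal of the forest edge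
`ab` splits a tree. -/
def IsReplacement (A : V → V → Prop) (S : V → V → V → V → Prop) (a b c d : V) : Prop :=
  (A c d ∧ ¬ S c d a b) ∧
    ∀ c' d', (A c' d' ∧ ¬ S c' d' a b) → ((c ≤ c' ∧ c ≠ c') ∨ (c = c' ∧ d ≤ d'))

/-- The update of `forestRel` on the deletion of the edge `ab`; `A` is adjacency after the
deletion. -/
def deleteRel (A : V → V → Prop) (S : V → V → V → V → Prop) (a b x y u v : V) : Prop :=
  ¬ (S a b a a ∧ ¬ S a b a b) ∧ S x y u v ∨
    (S a b a a ∧ ¬ S a b a b) ∧ ((S x y u v ∧ S x y a b) ∨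
      ∃ c d, IsReplacement A S a b c d ∧
        addEdgeRel (fun x y u v => S x y u v ∧ S x y a b) c d x y u v)

theorem IsReplacement.unique {A : V → V → Prop} {S : V → V → V → V → Prop} {a b c d c' d' : V}
    (h : IsReplacement A S a b c d) (h' : IsReplacement A S a b c' d') : c = c' ∧ d = d' := by
  have h1 := h.2 _ _ h'.1
  have h2 := h'.2 _ _ h.1
  grind

theorem exists_isReplacement [Finite V] {A : V → V → Prop} {S : V → V → V → V → Prop}
    {a b c d : V} (h : A c d ∧ ¬ S c d a b) : ∃ c d, IsReplacement A S a b c d := by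
  obtain ⟨q, hq, hmin⟩ := Set.exists_min_image {q : V × V | A q.1 q.2 ∧ ¬ S q.1 q.2 a b}
    (fun q => toLex q) (Set.toFinite _) ⟨(c, d), h⟩
  refine ⟨q.1, q.2, hq, fun c' d' h' => ?_⟩
  have := hmin (c', d') h'
  rw [Prod.Lex.toLex_le_toLex] at this
  exact this.imp (fun h => ⟨h.le, h.ne⟩) id

theorem IsSpanningForest.exists_delete [Finite V] {F H : SimpleGraph V} (h : IsSpanningForest F H)
    (a b : V) : ∃ F', IsSpanningForest F' (H.deleteEdges {s(a, b)}) ∧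
      ∀ x y u v, forestRel F' x y u v ↔
        deleteRel (H.deleteEdges {s(a, b)}).Adj (forestRel F) a b x y u v := by
  set H' := H.deleteEdges {s(a, b)} with hH'
  by_cases hab : F.Adj a b
  swap
  · refine ⟨F, ⟨fun x y hxy => ?_, h.acyclic, fun x y hxy =>
      h.spanning x y (hxy.mono (SimpleGraph.deleteEdges_le _))⟩, fun x y u v => ?_⟩
    · rw [hH', SimpleGraph.deleteEdges_adj]
      refine ⟨h.le hxy, fun e => ?_⟩
      rw [Set.mem_singleton_iff, Sym2.eq_iff] at e
      rcases e with ⟨rfl, rfl⟩ | ⟨rfl, rfl⟩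
      · exact hab hxy
      · exact hab hxy.symm
    · simp only [deleteRel, ← forest_adj_iff h.acyclic, hab, not_false_eq_true, true_and,
        false_and, or_false]
  set F₀ := F.deleteEdges {s(a, b)} with hF₀
  have hle : F₀ ≤ H' := SimpleGraph.deleteEdges_mono h.le
  have hac : F₀.IsAcyclic := h.acyclic.anti (SimpleGraph.deleteEdges_le _)
  have hF : F = F₀ ⊔ SimpleGraph.edge a b := by
    ext x y
    simp only [hF₀, SimpleGraph.deleteEdges_adj, SimpleGraph.sup_adj, SimpleGraph.edge_adj,
      Set.mem_singleton_iff, Sym2.eq_iff]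
    have := hab.symm
    grind [SimpleGraph.Adj.ne]
  have hS : ∀ x y u v, forestRel F₀ x y u v ↔ forestRel F x y u v ∧ forestRel F x y a b :=
    fun x y u v => forestRel_deleteEdges h.acyclic
  -- Since `F` is `F₀` plus `ab`, connected vertices of `H'` lie in one tree of `F₀` or in the two
  -- parts left by the removal of `ab`.
  have hsplit : ∀ x y, H'.Reachable x y → F₀.Reachable x y ∨
      F₀.Reachable x a ∧ F₀.Reachable b y ∨ F₀.Reachable x b ∧ F₀.Reachable a y := by
    intro x y hxy
    rw [← reachable_sup_edge_iff, ← hF]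
    exact h.spanning _ _ (hxy.mono (SimpleGraph.deleteEdges_le _))
  by_cases hex : ∃ c d, H'.Adj c d ∧ ¬ forestRel F c d a b
  · obtain ⟨c, d, hcd⟩ : ∃ c d, IsReplacement H'.Adj (forestRel F) a b c d := by
      obtain ⟨c, d, hcd⟩ := hex
      exact exists_isReplacement hcd
    have hnr : ¬ F₀.Reachable c d := hcd.1.2
    refine ⟨F₀ ⊔ SimpleGraph.edge c d, ⟨sup_le hle ?_, hac.sup_edge_of_not_reachable hnr,
      fun x y hxy => ?_⟩, fun x y u v => ?_⟩
    · exact (SimpleGraph.edge_le_iff _).2 (Or.inr hcd.1.1)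
    · have h1 := hsplit x y hxy
      -- The replacement edge has one end in each part, so a passage through `ab` can be replaced by
      -- a passage through `cd`.
      have h2 := (hsplit c d hcd.1.1.reachable).resolve_left hnr
      rw [reachable_sup_edge_iff]
      rcases h1 with h1 | ⟨h1, h1'⟩ | ⟨h1, h1'⟩
      · exact Or.inl h1
      · rcases h2 with ⟨h2, h2'⟩ | ⟨h2, h2'⟩
        · exact Or.inr (Or.inl ⟨h1.trans h2.symm, h2'.symm.trans h1'⟩)
        · exact Or.inr (Or.inr ⟨h1.trans h2', h2.trans h1'⟩)
      · rcases h2 with ⟨h2, h2'⟩ | ⟨h2, h2'⟩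
        · exact Or.inr (Or.inr ⟨h1.trans h2', h2.trans h1'⟩)
        · exact Or.inr (Or.inl ⟨h1.trans h2.symm, h2'.symm.trans h1'⟩)
    · rw [forestRel_sup_edge]
      simp only [deleteRel, ← forest_adj_iff h.acyclic, hab, not_true, true_and, false_and,
        false_or]
      have e : forestRel F₀ = fun x y u v => forestRel F x y u v ∧ forestRel F x y a b := by
        funext x y u v
        exact propext (hS x y u v)
      rw [e]
      constructor
      · exact fun h' => Or.inr ⟨c, d, hcd, h'⟩
      · rintro (h' | ⟨c', d', hcd', h'⟩)
        · exact Or.inl h'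
        · obtain ⟨rfl, rfl⟩ := hcd.unique hcd'
          exact h'
  · push Not at hex
    refine ⟨F₀, ⟨hle, hac, fun x y hxy => ?_⟩, fun x y u v => ?_⟩
    · obtain ⟨p⟩ := hxy
      induction p with
      | nil => exact .rfl
      | cons hc _ ih => exact SimpleGraph.Reachable.trans (hex _ _ hc) ih
    · rw [hS]
      simp only [deleteRel, ← forest_adj_iff h.acyclic, hab, not_true, true_and, false_and,
        false_or]
      refine ⟨Or.inl, fun h' => h'.resolve_right ?_⟩
      rintro ⟨c, d, hcd, -⟩
      exact hcd.1.2 (hex _ _ hcd.1.1)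

end Forest

/-! ### Queries that are first-order in avoiding reachability are in DynFO -/

section Maintenance

/-- The graph `G` without the edges at `a` and `b`. -/
def avoidGraph {V : Type} (G : SimpleGraph V) (a b : V) : SimpleGraph V where
  Adj x y := G.Adj x y ∧ x ≠ a ∧ x ≠ b ∧ y ≠ a ∧ y ≠ b
  symm := ⟨fun _ _ h => ⟨h.1.symm, h.2.2.2.1, h.2.2.2.2, h.2.1, h.2.2.1⟩⟩
  loopless := ⟨fun _ h => h.1.ne rfl⟩

/-- `avoidGraph` keeps `a` and `b` as isolated vertices, so that all forests live on the same
domain. The conditions on `x` and `y` exclude the trivial walks at these two vertices. -/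
theorem walkIn_compl_pair_iff {V : Type} {G : SimpleGraph V} {a b x y : V} :
    WalkIn G {a, b}ᶜ x y ↔
      (x ≠ a ∧ x ≠ b) ∧ (y ≠ a ∧ y ≠ b) ∧ (avoidGraph G a b).Reachable x y := by
  constructor
  · rintro ⟨p, hp⟩
    have hx := hp _ p.start_mem_support
    have hy := hp _ p.end_mem_support
    simp only [Set.mem_compl_iff, Set.mem_insert_iff, Set.mem_singleton_iff, not_or] at hx hy hp
    refine ⟨hx, hy, ?_⟩
    clear hx hy
    induction p with
    | nil => exact .rfl
    | @cons u v w h p ih =>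
      have h' : (avoidGraph G a b).Adj u v :=
        ⟨h, (hp u (by simp)).1, (hp u (by simp)).2, (hp v (by simp)).1, (hp v (by simp)).2⟩
      exact h'.reachable.trans (ih fun w hw => hp w (by simp [hw]))
  · rintro ⟨hx, hy, ⟨p⟩⟩
    induction p with
    | nil => exact ⟨.nil, by simp [hx]⟩
    | @cons u v w h p ih =>
      obtain ⟨q, hq⟩ := ih ⟨h.2.2.2.1, h.2.2.2.2⟩ hy
      refine ⟨.cons h.1 q, ?_⟩
      rw [SimpleGraph.Walk.support_cons]
      rintro w (_ | ⟨_, hw⟩)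
      · simp [hx]
      · exact hq w hw

theorem avoidGraph_sup_edge {V : Type} {G : SimpleGraph V} {a b u v : V}
    (h : (u ≠ a ∧ u ≠ b) ∧ (v ≠ a ∧ v ≠ b)) :
    avoidGraph (G ⊔ SimpleGraph.edge u v) a b = avoidGraph G a b ⊔ SimpleGraph.edge u v := by
  ext x y
  simp only [avoidGraph, SimpleGraph.sup_adj, SimpleGraph.edge_adj]
  grind

theorem avoidGraph_sup_edge_of_not {V : Type} {G : SimpleGraph V} {a b u v : V}
    (h : ¬ ((u ≠ a ∧ u ≠ b) ∧ (v ≠ a ∧ v ≠ b))) :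
    avoidGraph (G ⊔ SimpleGraph.edge u v) a b = avoidGraph G a b := by
  ext x y
  simp only [avoidGraph, SimpleGraph.sup_adj, SimpleGraph.edge_adj]
  grind

theorem avoidGraph_deleteEdges {V : Type} {G : SimpleGraph V} {a b u v : V} :
    avoidGraph (G.deleteEdges {s(u, v)}) a b = (avoidGraph G a b).deleteEdges {s(u, v)} := by
  ext x y
  simp only [avoidGraph, SimpleGraph.deleteEdges_adj]
  tauto

variable {n : ℕ}

/-- The 4-ary relation for the pair `a, b` that is stored in a 6-ary relation. -/
def storedRel (A : Set (Fin 6 → Fin n)) (a b x y u v : Fin n) : Prop := ![a, b, x, y, u, v] ∈ A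

/-- `A` stores, for every pair `a, b`, a spanning forest of the graph `G` without the edges at `a`
and `b`. -/
def StoresForests (G : SimpleGraph (Fin n)) (A : Set (Fin 6 → Fin n)) : Prop :=
  ∀ a b, ∃ F, IsSpanningForest F (avoidGraph G a b) ∧ ∀ x y u v,
    storedRel A a b x y u v ↔ forestRel F x y u v

/-- The update of the stored forests on the insertion of the edge `uv`. -/
def storeInsert (A : Set (Fin 6 → Fin n)) (u v a b x y p q : Fin n) : Prop :=
  ((u ≠ a ∧ u ≠ b) ∧ (v ≠ a ∧ v ≠ b)) ∧ insertRel (storedRel A a b) u v x y p q ∨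
    ¬ ((u ≠ a ∧ u ≠ b) ∧ (v ≠ a ∧ v ≠ b)) ∧ storedRel A a b x y p q

/-- The update of the stored forests on the deletion of the edge `uv`. -/
def storeDelete (G : SimpleGraph (Fin n)) (A : Set (Fin 6 → Fin n)) (u v a b x y p q : Fin n) :
    Prop :=
  deleteRel (fun c d => (G.Adj c d ∧ c ≠ a ∧ c ≠ b ∧ d ≠ a ∧ d ≠ b) ∧
    ¬ (c = u ∧ d = v ∨ c = v ∧ d = u)) (storedRel A a b) u v x y p q

theorem eq_vec_six {β : Type} (w : Fin 6 → β) : ![w 0, w 1, w 2, w 3, w 4, w 5] = w := by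
  funext i
  fin_cases i <;> rfl

variable {G : SimpleGraph (Fin n)} {A : Set (Fin 6 → Fin n)}

theorem StoresForests.insert (h : StoresForests G A) (u v : Fin n) :
    StoresForests (G ⊔ SimpleGraph.edge u v)
      {w | storeInsert A u v (w 0) (w 1) (w 2) (w 3) (w 4) (w 5)} := by
  intro a b
  obtain ⟨F, hF, hS⟩ := h a b
  have e : storedRel A a b = forestRel F := by
    funext x y u v
    exact propext (hS x y u v)
  by_cases hab : (u ≠ a ∧ u ≠ b) ∧ (v ≠ a ∧ v ≠ b)
  · obtain ⟨F', hF', hS'⟩ := hF.exists_insert u v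
    refine ⟨F', by rwa [avoidGraph_sup_edge hab], fun x y p q => ?_⟩
    rw [hS', ← e]
    change storeInsert A u v a b x y p q ↔ _
    simp only [storeInsert, hab, not_true, false_and, or_false, true_and, ne_eq,
      not_false_eq_true, and_self]
  · refine ⟨F, by rwa [avoidGraph_sup_edge_of_not hab], fun x y p q => ?_⟩
    rw [← e]
    change storeInsert A u v a b x y p q ↔ _
    simp only [storeInsert, hab, not_false_eq_true, false_and, false_or, true_and]

/-- In contrast to insertion, no case distinction on `a`, `b` is needed: an edge at `a` or `b` is
absent from `avoidGraph G a b`, and deleting an absent edge is covered by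
`IsSpanningForest.exists_delete`. -/
theorem StoresForests.delete (h : StoresForests G A) (u v : Fin n) :
    StoresForests (G.deleteEdges {s(u, v)})
      {w | storeDelete G A u v (w 0) (w 1) (w 2) (w 3) (w 4) (w 5)} := by
  intro a b
  obtain ⟨F, hF, hS⟩ := h a b
  have e : storedRel A a b = forestRel F := by
    funext x y u v
    exact propext (hS x y u v)
  obtain ⟨F', hF', hS'⟩ := hF.exists_delete u v
  refine ⟨F', by rwa [avoidGraph_deleteEdges], fun x y p q => ?_⟩
  rw [hS', ← e]
  change storeDelete G A u v a b x y p q ↔ _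
  have e' : ((avoidGraph G a b).deleteEdges {s(u, v)}).Adj = fun c d =>
      (G.Adj c d ∧ c ≠ a ∧ c ≠ b ∧ d ≠ a ∧ d ≠ b) ∧ ¬ (c = u ∧ d = v ∨ c = v ∧ d = u) := by
    funext c d
    simp only [SimpleGraph.deleteEdges_adj, avoidGraph, Set.mem_singleton_iff, Sym2.eq_iff]
  rw [e', storeDelete]

theorem storesForests_bot :
    StoresForests (⊥ : SimpleGraph (Fin n)) {w | w 2 = w 3} := by
  intro a b
  have e : avoidGraph (⊥ : SimpleGraph (Fin n)) a b = ⊥ := by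
    ext x y
    simp [avoidGraph]
  refine ⟨⊥, ⟨bot_le, SimpleGraph.isAcyclic_bot, fun x y h => by rwa [e] at h⟩, fun x y u v => ?_⟩
  have e' : (⊥ : SimpleGraph (Fin n)).deleteEdges {s(u, v)} = ⊥ := by
    ext x y
    simp
  rw [forestRel, e', SimpleGraph.reachable_bot]
  rfl

theorem StoresForests.walkIn_iff (h : StoresForests G A) {a b x y : Fin n} :
    WalkIn G {a, b}ᶜ x y ↔
      (x ≠ a ∧ x ≠ b) ∧ (y ≠ a ∧ y ≠ b) ∧ storedRel A a b x y x x := by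
  obtain ⟨F, hF, hS⟩ := h a b
  rw [walkIn_compl_pair_iff, hS, forestRel_diag]
  have : (avoidGraph G a b).Reachable x y ↔ F.Reachable x y :=
    ⟨hF.spanning _ _, fun h => h.mono hF.le⟩
  rw [this]

/-- The auxiliary schema that consists of the stored forests and the result of a `k`-ary query. -/
def storeArity (k : ℕ) : Fin 2 → ℕ
  | 0 => 6
  | 1 => k

/-- A state in which the auxiliary relation `0` stores spanning forests. -/
structure StoreState (k : ℕ) where
  size : ℕ
  graph : SimpleGraph (Fin size)
  aux : ∀ i, Set (Fin (storeArity k i) → Fin size)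
  stores : StoresForests graph (aux 0)

/-- The structures in which update formulas are evaluated. -/
@[reducible]
def StoreState.structure {k : ℕ} (s : StoreState k) :
    (dynLang (storeArity k)).Structure (Fin s.size) :=
  dynStructure (storeArity k) s.graph s.aux

section

variable {k : ℕ} {α : Type}

theorem uDef_edge (a b : α) : UDef (StoreState.structure (k := k))
    (fun s x => s.graph.Adj (x a) (x b)) :=
  (UDef.rel (DynRel.edge : DynRel (storeArity k) 2) ![a, b]).congr fun _ _ => Iff.rfl

theorem uDef_le (a b : α) : UDef (StoreState.structure (k := k)) (fun _ x => x a ≤ x b) :=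
  (UDef.rel (DynRel.le : DynRel (storeArity k) 2) ![a, b]).congr fun _ _ => Iff.rfl

theorem uDef_storedRel (a b c d e f : α) : UDef (StoreState.structure (k := k))
    (fun s x => storedRel (s.aux 0) (x a) (x b) (x c) (x d) (x e) (x f)) :=
  (UDef.rel (DynRel.aux 0 : DynRel (storeArity k) (storeArity k 0))
    (![a, b, c, d, e, f] : Fin 6 → α)).congr fun s x => 
      iff_of_eq (congrArg (· ∈ s.aux 0)
        (eq_vec_six (fun j => x ((![a, b, c, d, e, f] : Fin 6 → α) j))).symm)

/-- The relation `S` is arbitrary because insertion applies this to the stored forest, and deletion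
to the forest that has just lost an edge. -/
theorem uDef_addEdgeRel {S : ∀ s : StoreState k, (α → Fin s.size) → Fin s.size → Fin s.size →
      Fin s.size → Fin s.size → Prop}
    (hS : ∀ c d e f : α, UDef StoreState.structure (fun s x => S s x (x c) (x d) (x e) (x f)))
    (a b c d e f : α) : UDef (StoreState.structure (k := k))
      (fun s x => addEdgeRel (S s x) (x a) (x b) (x c) (x d) (x e) (x f)) :=
  (hS _ _ _ _).or ((((UDef.eq _ _).and (UDef.eq _ _)).or ((UDef.eq _ _).and (UDef.eq _ _))).not.and
    (((hS _ _ _ _).and (hS _ _ _ _)).or ((hS _ _ _ _).and (hS _ _ _ _))))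

theorem uDef_storeInsert (u v a b c d e f : α) : UDef (StoreState.structure (k := k))
    (fun s x => storeInsert (s.aux 0) (x u) (x v) (x a) (x b) (x c) (x d) (x e) (x f)) := by
  have hS := uDef_storedRel (k := k) a b
  refine UDef.or (UDef.and ((UDef.ne_and_ne _ _ _).and (UDef.ne_and_ne _ _ _)) ?_)
    (UDef.and ((UDef.ne_and_ne _ _ _).and (UDef.ne_and_ne _ _ _)).not (hS _ _ _ _))
  exact ((hS _ _ _ _).and (hS _ _ _ _)).or ((hS _ _ _ _).not.and
    (uDef_addEdgeRel (S := fun s x => storedRel (s.aux 0) (x a) (x b)) hS _ _ _ _ _ _))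

theorem uDef_storeDelete (u v a b c d e f : α) : UDef (StoreState.structure (k := k))
    (fun s x => storeDelete s.graph (s.aux 0) (x u) (x v) (x a) (x b) (x c) (x d) (x e) (x f)) := by
  have hS := fun {α : Type} => uDef_storedRel (k := k) (α := α)
  have hcand : ∀ {α : Type} (u v a b c d : α), UDef (StoreState.structure (k := k)) (fun s x =>
      (((s.graph.Adj (x c) (x d) ∧ x c ≠ x a ∧ x c ≠ x b ∧ x d ≠ x a ∧ x d ≠ x b) ∧
        ¬ (x c = x u ∧ x d = x v ∨ x c = x v ∧ x d = x u)) ∧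
          ¬ storedRel (s.aux 0) (x a) (x b) (x c) (x d) (x u) (x v))) := fun u v a b c d =>
    (((uDef_edge c d).and ((UDef.ne c a).and ((UDef.ne c b).and ((UDef.ne d a).and
      (UDef.ne d b))))).and (((UDef.eq c u).and (UDef.eq d v)).or
        ((UDef.eq c v).and (UDef.eq d u))).not).and (hS a b c d u v).not
  have hf : UDef (StoreState.structure (k := k)) (fun s x =>
      storedRel (s.aux 0) (x a) (x b) (x u) (x v) (x u) (x u) ∧
        ¬ storedRel (s.aux 0) (x a) (x b) (x u) (x v) (x u) (x v)) :=
    (hS _ _ _ _ _ _).and (hS _ _ _ _ _ _).not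
  refine (hf.not.and (hS _ _ _ _ _ _)).or (hf.and (((hS _ _ _ _ _ _).and (hS _ _ _ _ _ _)).or
    (UDef.ex (UDef.ex (UDef.and (UDef.and (hcand _ _ _ _ _ _) (UDef.all (UDef.all
      ((hcand _ _ _ _ _ _).imp (((uDef_le _ _).and (UDef.ne _ _)).or
        ((UDef.eq _ _).and (uDef_le _ _))))))) ?_)))))
  exact uDef_addEdgeRel (S := fun s (x : Option (Option α) → Fin s.size) p q y z =>
    storedRel (s.aux 0) (x (some (some a))) (x (some (some b))) p q y z ∧
      storedRel (s.aux 0) (x (some (some a))) (x (some (some b))) p q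
        (x (some (some u))) (x (some (some v))))
    (fun _ _ _ _ => (hS _ _ _ _ _ _).and (hS _ _ _ _ _ _)) (some none) none (some (some c))
    (some (some d)) (some (some e)) (some (some f))

end

/-- Queries that are first-order definable from adjacency and avoiding reachability are in
DynFO. -/
theorem FOQ.inDynFO {k : ℕ} {Q : GraphQuery k} (hQ : FOQ (fun n G x => x ∈ Q n G)) :
    InDynFO Q := by
  let str₀ : ∀ n : ℕ, FirstOrder.Language.graph.Structure (Fin n) :=
    fun n => (⊥ : SimpleGraph (Fin n)).structure
  obtain ⟨i₀, hi₀⟩ : UDef str₀ (fun n (x : Fin 6 → Fin n) => x 2 = x 3) := UDef.eq _ _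
  obtain ⟨i₁, hi₁⟩ : UDef str₀ (fun n (x : Fin k → Fin n) => x ∈ Q n ⊥) := by
    have h := hQ.uDef (str := str₀) (β := Empty) (fun n _ => ⊥)
      (UDef.false.congr fun n x => by simp)
      ((((UDef.ne_and_ne _ _ _).and ((UDef.ne_and_ne _ _ _).and
        (UDef.eq (Sum.inl 2) (Sum.inl 3))))).congr fun n x => by
          rw [storesForests_bot.walkIn_iff]
          rfl)
    exact h.comp (Sum.elim id Empty.elim)
  obtain ⟨p₀, hp₀⟩ : UDef (StoreState.structure (k := k)) (fun s (x : Fin 6 ⊕ Fin 2 → _) =>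
      storeInsert (s.aux 0) (x (.inr 0)) (x (.inr 1)) (x (.inl 0)) (x (.inl 1)) (x (.inl 2))
        (x (.inl 3)) (x (.inl 4)) (x (.inl 5))) := uDef_storeInsert _ _ _ _ _ _ _ _
  obtain ⟨d₀, hd₀⟩ : UDef (StoreState.structure (k := k)) (fun s (x : Fin 6 ⊕ Fin 2 → _) =>
      storeDelete s.graph (s.aux 0) (x (.inr 0)) (x (.inr 1)) (x (.inl 0)) (x (.inl 1))
        (x (.inl 2)) (x (.inl 3)) (x (.inl 4)) (x (.inl 5))) := uDef_storeDelete _ _ _ _ _ _ _ _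
  -- Update formulas see only the state before the change. The query on the new graph is therefore
  -- expressed by substituting definitions of the new adjacency and of the new avoiding
  -- reachability, which is read off the updated forests.
  obtain ⟨p₁, hp₁⟩ : UDef (StoreState.structure (k := k)) (fun s (x : Fin k ⊕ Fin 2 → _) =>
      (fun a => x (.inl a)) ∈ Q s.size (s.graph ⊔ SimpleGraph.edge (x (.inr 0)) (x (.inr 1)))) := by
    refine hQ.uDef (str := StoreState.structure (k := k)) (β := Fin 2)
      (fun s w => s.graph ⊔ SimpleGraph.edge (w 0) (w 1)) ?_ ?_
    · refine UDef.congr ((uDef_edge (.inl 0) (.inl 1)).or (((((UDef.eq (.inl 0) (.inr 0)).and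
        (UDef.eq (.inl 1) (.inr 1))).or ((UDef.eq (.inl 0) (.inr 1)).and
          (UDef.eq (.inl 1) (.inr 0)))).and (UDef.ne (.inl 0) (.inl 1))))) fun s x => ?_
      rw [SimpleGraph.sup_adj, SimpleGraph.edge_adj]
    · refine UDef.congr ((UDef.ne_and_ne (.inl 0) (.inl 1) (.inl 2)).and
        ((UDef.ne_and_ne (.inl 0) (.inl 1) (.inl 3)).and (uDef_storeInsert (.inr 0) (.inr 1)
          (.inl 0) (.inl 1) (.inl 2) (.inl 3) (.inl 2) (.inl 2)))) fun s x => ?_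
      rw [(s.stores.insert _ _).walkIn_iff]
      rfl
  obtain ⟨d₁, hd₁⟩ : UDef (StoreState.structure (k := k)) (fun s (x : Fin k ⊕ Fin 2 → _) =>
      (fun a => x (.inl a)) ∈ Q s.size (s.graph.deleteEdges {s(x (.inr 0), x (.inr 1))})) := by
    refine hQ.uDef (str := StoreState.structure (k := k)) (β := Fin 2)
      (fun s w => s.graph.deleteEdges {s(w 0, w 1)}) ?_ ?_
    · refine UDef.congr ((uDef_edge (.inl 0) (.inl 1)).and ((((UDef.eq (.inl 0) (.inr 0)).and
        (UDef.eq (.inl 1) (.inr 1))).or ((UDef.eq (.inl 0) (.inr 1)).and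
          (UDef.eq (.inl 1) (.inr 0)))).not)) fun s x => ?_
      rw [SimpleGraph.deleteEdges_adj, Set.mem_singleton_iff, Sym2.eq_iff]
    · refine UDef.congr ((UDef.ne_and_ne (.inl 0) (.inl 1) (.inl 2)).and
        ((UDef.ne_and_ne (.inl 0) (.inl 1) (.inl 3)).and (uDef_storeDelete (.inr 0) (.inr 1)
          (.inl 0) (.inl 1) (.inl 2) (.inl 3) (.inl 2) (.inl 2)))) fun s x => ?_
      rw [(s.stores.delete _ _).walkIn_iff]
      rfl
  let P : DynProgram :=
    { numRel := 2
      arity := storeArity k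
      init := fun | 0 => i₀ | 1 => i₁
      ins := fun | 0 => p₀ | 1 => p₁
      del := fun | 0 => d₀ | 1 => d₁ }
  -- Relation `1` is recomputed from the forests at every change, so only relation `0` carries
  -- information from one state to the next.
  have inv : ∀ (n : ℕ) (α : List (EdgeChange n)),
      StoresForests (P.run α).graph ((P.run α).aux 0) ∧
        (P.run α).aux 1 = Q n (P.run α).graph := by
    intro n α
    induction α using List.reverseRecOn with
    | nil =>
      constructor
      · have e : (P.run ([] : List (EdgeChange n))).aux 0 = {w : Fin 6 → Fin n | w 2 = w 3} :=
          Set.ext fun x => hi₀ n x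
        rw [e]
        exact storesForests_bot
      · exact Set.ext fun x => hi₁ n x
    | append_singleton α δ ih =>
      have hrun : P.run (α ++ [δ]) = P.step (P.run α) δ := by
        simp [DynProgram.run]
      rw [hrun]
      let s : StoreState k := ⟨n, (P.run α).graph, (P.run α).aux, ih.1⟩
      cases δ with
      | ins u v huv =>
        constructor
        · have e : (P.step (P.run α) (.ins u v huv)).aux 0 =
              {w : Fin 6 → Fin n |
                storeInsert (s.aux 0) u v (w 0) (w 1) (w 2) (w 3) (w 4) (w 5)} :=
            Set.ext fun x => hp₀ s (Sum.elim x ![u, v])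
          rw [e]
          exact s.stores.insert u v
        · exact Set.ext fun x => hp₁ s (Sum.elim x ![u, v])
      | del u v huv =>
        constructor
        · have e : (P.step (P.run α) (.del u v huv)).aux 0 =
              {w : Fin 6 → Fin n |
                storeDelete s.graph (s.aux 0) u v (w 0) (w 1) (w 2) (w 3) (w 4) (w 5)} :=
            Set.ext fun x => hd₀ s (Sum.elim x ![u, v])
          rw [e]
          exact s.stores.delete u v
        · exact Set.ext fun x => hd₁ s (Sum.elim x ![u, v])
  refine ⟨P, 1, rfl, fun n α x => ?_⟩
  change x ∈ (P.run α).aux 1 ↔ _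
  rw [(inv n α).2]
  exact Iff.rfl

end Maintenance

/-! ### Walks inside vertex sets -/

section Blocks

variable {V : Type} {G : SimpleGraph V} {U U' : Set V} {x y z : V}

namespace WalkIn

theorem refl (h : x ∈ U) : WalkIn G U x x := ⟨.nil, by simpa⟩

theorem left_mem (h : WalkIn G U x y) : x ∈ U := h.elim fun p hp => hp _ p.start_mem_support

theorem right_mem (h : WalkIn G U x y) : y ∈ U := h.elim fun p hp => hp _ p.end_mem_support

theorem symm (h : WalkIn G U x y) : WalkIn G U y x := by
  obtain ⟨p, hp⟩ := h
  exact ⟨p.reverse, fun w hw => hp w (by simpa using hw)⟩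

theorem trans (h : WalkIn G U x y) (h' : WalkIn G U y z) : WalkIn G U x z := by
  obtain ⟨p, hp⟩ := h
  obtain ⟨q, hq⟩ := h'
  refine ⟨p.append q, fun w hw => ?_⟩
  rw [SimpleGraph.Walk.mem_support_append_iff] at hw
  exact hw.elim (hp w) (hq w)

theorem mono (h : WalkIn G U x y) (hU : U ⊆ U') : WalkIn G U' x y :=
  h.imp fun _ hp w hw => hU (hp w hw)

theorem of_adj (h : G.Adj x y) (hx : x ∈ U) (hy : y ∈ U) : WalkIn G U x y :=
  ⟨h.toWalk, by simp [hx, hy]⟩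

theorem head_induction {P : V → Prop} (h : WalkIn G U x y) (hy : P y)
    (step : ∀ a b, G.Adj a b → a ∈ U → WalkIn G U b y → P b → P a) : P x := by
  obtain ⟨p, hp⟩ := h
  induction p with
  | nil => exact hy
  | cons h p ih =>
    have hp' : ∀ w ∈ p.support, w ∈ U := fun w hw => hp w (by simp [hw])
    exact step _ _ h (hp _ (by simp)) ⟨p, hp'⟩ (ih hy step hp')

/-- A walk stays in the set of vertices that are reachable from its start. -/
theorem restrict (h : WalkIn G U x y) : WalkIn G {w | WalkIn G U x w} x y := by
  have h' : WalkIn G {w | WalkIn G U w y} x y :=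
    h.head_induction (P := fun x => WalkIn G {w | WalkIn G U w y} x y)
      (refl (U := {w | WalkIn G U w y}) (refl h.right_mem))
      fun a b hab ha hb ih => (of_adj hab ((of_adj hab ha hb.left_mem).trans hb) hb).trans ih
  exact h'.mono fun w hw => h.trans (symm hw)

/-- The last vertex but one of a path. -/
theorem exists_adj_end (h : WalkIn G U x y) (hxy : x ≠ y) :
    ∃ w, G.Adj w y ∧ WalkIn G (U \ {y}) x w := by
  refine h.head_induction (P := fun x => x ≠ y → ∃ w, G.Adj w y ∧ WalkIn G (U \ {y}) x w)
    (fun h => absurd rfl h) (fun a b hab ha hb ih hay => ?_) hxy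
  by_cases hby : b = y
  · subst hby
    exact ⟨a, hab, refl ⟨ha, hay⟩⟩
  · obtain ⟨w, hw, h'⟩ := ih hby
    exact ⟨w, hw, (of_adj (U := U \ {y}) hab ⟨ha, hay⟩ ⟨hb.left_mem, hby⟩).trans h'⟩

theorem univ_iff : WalkIn G Set.univ x y ↔ G.Reachable x y :=
  ⟨fun ⟨p, _⟩ => ⟨p⟩, fun ⟨p⟩ => ⟨p, fun _ _ => trivial⟩⟩

end WalkIn

theorem reachable_induce_iff (hx : x ∈ U) (hy : y ∈ U) :
    (G.induce U).Reachable ⟨x, hx⟩ ⟨y, hy⟩ ↔ WalkIn G U x y := by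
  constructor
  · rintro ⟨p⟩
    have h : ∀ w ∈ (p.map (SimpleGraph.Embedding.induce U).toHom).support, w ∈ U := by
      intro w hw
      rw [SimpleGraph.Walk.support_map, List.mem_map] at hw
      obtain ⟨w', -, rfl⟩ := hw
      exact w'.2
    exact ⟨_, h⟩
  · rintro ⟨p, hp⟩
    exact ⟨p.induce U hp⟩

theorem connOn_iff : ConnOn G U ↔ ∀ x ∈ U, ∀ y ∈ U, WalkIn G U x y := by
  constructor
  · intro h x hx y hy
    exact (reachable_induce_iff hx hy).1 (h ⟨x, hx⟩ ⟨y, hy⟩)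
  · rintro h ⟨x, hx⟩ ⟨y, hy⟩
    exact (reachable_induce_iff hx hy).2 (h x hx y hy)

/-- Removing a vertex outside `U` changes nothing, so the condition may range over all vertices. -/
theorem biconnOn_iff : BiconnOn G U ↔ ConnOn G U ∧ ∀ v, ConnOn G (U \ {v}) := by
  refine and_congr_right fun h => forall_congr' fun v => ?_
  rw [IsCutVertexOn, not_and, not_not]
  refine ⟨fun h' => ?_, fun h' _ => h'⟩
  by_cases hv : v ∈ U
  · exact h' hv
  · rwa [Set.sdiff_singleton_eq_self hv]

/-! ### Blocks -/

/-- `w` is separated by no vertex from the pair `x, y`. -/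
def block (G : SimpleGraph V) (x y : V) : Set V :=
  {w | ∀ z, z ≠ w → WalkIn G {z}ᶜ w x ∨ WalkIn G {z}ᶜ w y}

/-- The vertices `x` and `y` are connected, and no other vertex separates them. -/
def Unseparated (G : SimpleGraph V) (x y : V) : Prop :=
  G.Reachable x y ∧ ∀ z, z ≠ x → z ≠ y → WalkIn G {z}ᶜ x y

theorem left_mem_block : x ∈ block G x y := fun _ h => Or.inl (.refl (by simpa using h.symm))

theorem right_mem_block : y ∈ block G x y := fun _ h => Or.inr (.refl (by simpa using h.symm))

/-- A path between two vertices of a block stays in the block. -/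
theorem WalkIn.inter_block {a b : V} (h : WalkIn G U a b) (ha : a ∈ block G x y)
    (hb : b ∈ block G x y) : WalkIn G (block G x y ∩ U) a b := by
  classical
  obtain ⟨p, hp⟩ := h
  refine ⟨p.toPath, fun q hq => ⟨fun z hz => ?_, hp q (p.support_bypass_subset_support hq)⟩⟩
  set r := p.toPath with hr
  have hpath := r.2
  rw [← r.1.take_spec hq] at hpath
  -- On a path, `z ≠ q` cannot lie both before and after `q`. Hence `q` reaches one of the ends `a`,
  -- `b` without `z`, and from there `x` or `y`.
  by_cases hz1 : z ∈ (r.1.takeUntil q hq).support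
  · have hz2 : z ∉ (r.1.dropUntil q hq).support := fun hz2 => by
      exact hpath.ne_of_mem_support_of_append hz.symm.symm hz1 hz2 rfl
    have hw : WalkIn G {z}ᶜ q b := ⟨r.1.dropUntil q hq, fun w hw => by
      rintro rfl
      exact hz2 hw⟩
    exact (hb z fun e => hw.right_mem e.symm).imp hw.trans hw.trans
  · have hw : WalkIn G {z}ᶜ a q := ⟨r.1.takeUntil q hq, fun w hw => by
      rintro rfl
      exact hz1 hw⟩
    exact (ha z fun e => hw.left_mem e.symm).imp hw.symm.trans hw.symm.trans

/-- Avoiding `z`, each of `a` and `b` reaches `x` or `y`. If they reach different ones, then `z` is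
neither `x` nor `y`, and `x`, `y` are connected without `z`. -/
theorem Unseparated.walkIn_compl {a b z : V} (h : Unseparated G x y) (ha : a ∈ block G x y)
    (hb : b ∈ block G x y) (haz : a ≠ z) (hbz : b ≠ z) : WalkIn G {z}ᶜ a b := by
  have hxy : WalkIn G {z}ᶜ a x → WalkIn G {z}ᶜ b y → WalkIn G {z}ᶜ x y := fun h1 h2 =>
    h.2 z (fun e => h1.right_mem e.symm) (fun e => h2.right_mem e.symm)
  have hxy' : WalkIn G {z}ᶜ b x → WalkIn G {z}ᶜ a y → WalkIn G {z}ᶜ x y := fun h1 h2 =>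
    h.2 z (fun e => h1.right_mem e.symm) (fun e => h2.right_mem e.symm)
  rcases ha z haz.symm with h1 | h1 <;> rcases hb z hbz.symm with h2 | h2
  · exact h1.trans h2.symm
  · exact h1.trans ((hxy h1 h2).trans h2.symm)
  · exact h1.trans ((hxy' h2 h1).symm.trans h2.symm)
  · exact h1.trans h2.symm

theorem Unseparated.reachable {a : V} (h : Unseparated G x y) (ha : a ∈ block G x y) :
    G.Reachable a x := by
  by_cases hax : a = x
  · rw [hax]
  · rcases ha x (Ne.symm hax) with h1 | h1
    · exact absurd rfl h1.right_mem
    · exact (WalkIn.univ_iff.1 (h1.mono (Set.subset_univ _))).trans h.1.symm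

theorem Unseparated.biconnOn_block (h : Unseparated G x y) : BiconnOn G (block G x y) := by
  rw [biconnOn_iff]
  refine ⟨connOn_iff.2 fun a ha b hb => ?_, fun z => connOn_iff.2 fun a ha b hb => ?_⟩
  · have h1 := WalkIn.univ_iff.2 ((h.reachable ha).trans (h.reachable hb).symm)
    exact (h1.inter_block ha hb).mono Set.inter_subset_left
  · exact (h.walkIn_compl ha.1 hb.1 ha.2 hb.2).inter_block ha.1 hb.1

theorem BiconnOn.subset_block (h : BiconnOn G U) (hx : x ∈ U) (hy : y ∈ U) (hxy : x ≠ y) :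
    U ⊆ block G x y := by
  intro w hw z hz
  rw [biconnOn_iff] at h
  have h' := connOn_iff.1 (h.2 z)
  have hsub : U \ {z} ⊆ {z}ᶜ := fun _ h => h.2
  by_cases hxz : x = z
  · exact Or.inr ((h' w ⟨hw, hz.symm⟩ y ⟨hy, fun e => hxy (hxz.trans e.symm)⟩).mono hsub)
  · exact Or.inl ((h' w ⟨hw, hz.symm⟩ x ⟨hx, hxz⟩).mono hsub)

theorem BiconnOn.unseparated (h : BiconnOn G U) (hx : x ∈ U) (hy : y ∈ U) :
    Unseparated G x y := by
  rw [biconnOn_iff] at h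
  refine ⟨WalkIn.univ_iff.1 ((connOn_iff.1 h.1 x hx y hy).mono (Set.subset_univ _)),
    fun z hzx hzy => ?_⟩
  exact (connOn_iff.1 (h.2 z) x ⟨hx, hzx.symm⟩ y ⟨hy, hzy.symm⟩).mono fun _ h => h.2

theorem Unseparated.of_adj (h : G.Adj x y) : Unseparated G x y :=
  ⟨h.reachable, fun _ hx hy => .of_adj h hx.symm hy.symm⟩

theorem block_self : block G x x = {x} := by
  refine Set.Subset.antisymm (fun w hw => ?_) (by simpa using left_mem_block)
  by_contra hwx
  exact (hw x (Ne.symm hwx)).elim (fun h => h.right_mem rfl) fun h => h.right_mem rfl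

/-- The biconnected components of the whole graph. -/
theorem isBiconnComp_univ_iff_of_ne (hx : x ∈ U) (hy : y ∈ U) (hxy : x ≠ y) :
    IsBiconnComp G Set.univ U ↔ Unseparated G x y ∧ U = block G x y := by
  constructor
  · intro h
    have hu := h.prop.2.unseparated hx hy
    exact ⟨hu, h.eq_of_subset ⟨Set.subset_univ _, hu.biconnOn_block⟩
      (h.prop.2.subset_block hx hy hxy)⟩
  · rintro ⟨hu, rfl⟩
    exact ⟨⟨Set.subset_univ _, hu.biconnOn_block⟩,
      fun X hX hle => hX.2.subset_block (hle hx) (hle hy) hxy⟩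

theorem biconnOn_singleton : BiconnOn G {x} := by
  rw [biconnOn_iff]
  constructor
  · rw [connOn_iff]
    rintro a rfl b rfl
    exact .refl rfl
  · intro v
    rw [connOn_iff]
    rintro a ⟨rfl, ha⟩ b ⟨rfl, -⟩
    exact .refl ⟨rfl, ha⟩

theorem BiconnOn.exists_adj (h : BiconnOn G U) (hx : x ∈ U) (hy : y ∈ U) (hxy : x ≠ y) :
    ∃ z ∈ U, G.Adj x z := by
  obtain ⟨z, hz, hzx⟩ := (connOn_iff.1 h.1 y hy x hx).exists_adj_end hxy.symm
  exact ⟨z, hzx.right_mem.1, hz.symm⟩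

theorem isBiconnComp_univ_singleton_iff :
    IsBiconnComp G Set.univ {x} ↔ ∀ w, ¬ G.Adj x w := by
  constructor
  · intro h w hw
    have hu := Unseparated.of_adj hw
    have h1 := h.eq_of_subset ⟨Set.subset_univ _, hu.biconnOn_block⟩
      (by simpa using left_mem_block)
    have h2 : w ∈ ({x} : Set V) := by
      rw [h1]
      exact right_mem_block
    exact hw.ne (Set.mem_singleton_iff.1 h2).symm
  · intro h
    refine ⟨⟨Set.subset_univ _, biconnOn_singleton⟩, fun X hX hle w hw => ?_⟩
    by_contra hwx
    obtain ⟨z, -, hz⟩ := hX.2.exists_adj (hle rfl) hw (Ne.symm hwx)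
    exact h z hz

/-- The empty set counts as biconnected, since `ConnOn` is vacuous on it; it is excluded only by
maximality. -/
theorem IsBiconnComp.nonempty {W : Set V} (h : IsBiconnComp G W U) (hx : x ∈ W) : U.Nonempty := by
  by_contra hU
  rw [Set.not_nonempty_iff_eq_empty] at hU
  subst hU
  exact h.le_of_ge ⟨Set.singleton_subset_iff.2 hx, biconnOn_singleton⟩ (Set.empty_subset _) rfl

/-- Every biconnected component is spanned by an edge or consists of an isolated vertex. -/
theorem isBiconnComp_univ_iff (hx : x ∈ U) : IsBiconnComp G Set.univ U ↔
    ∃ a b, (G.Adj a b ∨ a = b ∧ ∀ w, ¬ G.Adj a w) ∧ U = block G a b := by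
  constructor
  · intro h
    by_cases hs : U = {x}
    · subst hs
      exact ⟨x, x, Or.inr ⟨rfl, isBiconnComp_univ_singleton_iff.1 h⟩, block_self.symm⟩
    · obtain ⟨y, hy, hyx⟩ : ∃ y ∈ U, y ≠ x := by
        by_contra hcon
        push Not at hcon
        exact hs (Set.eq_singleton_iff_unique_mem.2 ⟨hx, hcon⟩)
      obtain ⟨z, hz, hxz⟩ := h.prop.2.exists_adj hx hy hyx.symm
      exact ⟨x, z, Or.inl hxz, ((isBiconnComp_univ_iff_of_ne hx hz hxz.ne).1 h).2⟩
  · rintro ⟨a, b, h | ⟨rfl, h⟩, rfl⟩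
    · exact (isBiconnComp_univ_iff_of_ne left_mem_block right_mem_block h.ne).2
        ⟨.of_adj h, rfl⟩
    · rw [block_self]
      exact isBiconnComp_univ_singleton_iff.2 h

/-- The biconnected components of a connected component. -/
theorem isBiconnComp_supp_iff {c : V} :
    IsBiconnComp G (G.connectedComponentMk c).supp U ↔
      IsBiconnComp G Set.univ U ∧ U.Nonempty ∧ U ⊆ (G.connectedComponentMk c).supp := by
  constructor
  · intro h
    have hne : U.Nonempty := h.nonempty (x := c) rfl
    refine ⟨⟨⟨Set.subset_univ _, h.prop.2⟩, fun X hX hle => ?_⟩, hne, h.prop.1⟩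
    refine h.le_of_ge ⟨fun w hw => ?_, hX.2⟩ hle
    obtain ⟨u, hu⟩ := hne
    have h1 := WalkIn.univ_iff.1 ((connOn_iff.1 hX.2.1 w hw u (hle hu)).mono (Set.subset_univ _))
    have h2 := h.prop.1 hu
    rw [SimpleGraph.ConnectedComponent.mem_supp_iff, SimpleGraph.ConnectedComponent.eq] at h2 ⊢
    exact h1.trans h2
  · rintro ⟨h, -, hU⟩
    exact ⟨⟨hU, h.prop.2⟩, fun X hX hle => h.le_of_ge ⟨Set.subset_univ _, hX.2⟩ hle⟩

end Blocks

/-! ### Two disjoint walks between two sets -/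

section Menger

variable {V : Type} {G : SimpleGraph V} {U W A B X : Set V} {a b : V}

/-- There are two disjoint subsets of `K` that contain walks between `A` and `B`. -/
def TwoLinked (G : SimpleGraph V) (K A B : Set V) : Prop :=
  ∃ C C', C ⊆ K ∧ C' ⊆ K ∧ Disjoint C C' ∧ (∃ s ∈ A, ∃ t ∈ B, WalkIn G C s t) ∧
    ∃ s ∈ A, ∃ t ∈ B, WalkIn G C' s t

/-- No single vertex meets all walks between `A` and `B` in `W`. -/
def TwoConnected (G : SimpleGraph V) (W A B : Set V) : Prop :=
  ∀ z, ∃ s ∈ A, ∃ t ∈ B, WalkIn G (W \ {z}) s t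

theorem TwoLinked.mono (h : TwoLinked G U A B) (hU : U ⊆ W) : TwoLinked G W A B := by
  obtain ⟨C, C', h1, h2, h3⟩ := h
  exact ⟨C, C', h1.trans hU, h2.trans hU, h3⟩

/-- The initial segment of a walk up to its first vertex in `X`. -/
theorem WalkIn.exists_hit (h : WalkIn G U a b) (hU : U ⊆ W) (X : Set V) :
    WalkIn G (W \ X) a b ∨
      ∃ t ∈ X, WalkIn G (U ∩ (X ∪ {r | WalkIn G (W \ X) a r})) a t := by
  refine h.head_induction (P := fun a => WalkIn G (W \ X) a b ∨
    ∃ t ∈ X, WalkIn G (U ∩ (X ∪ {r | WalkIn G (W \ X) a r})) a t) ?_ ?_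
  · by_cases hb : b ∈ X
    · exact Or.inr ⟨b, hb, .refl ⟨h.right_mem, Or.inl hb⟩⟩
    · exact Or.inl (.refl ⟨hU h.right_mem, hb⟩)
  · intro a c hac ha hc ih
    by_cases haX : a ∈ X
    · exact Or.inr ⟨a, haX, .refl ⟨ha, Or.inl haX⟩⟩
    have haa : a ∈ U ∩ (X ∪ {r | WalkIn G (W \ X) a r}) := ⟨ha, Or.inr (.refl ⟨hU ha, haX⟩)⟩
    rcases ih with ih | ⟨t, ht, ih⟩
    · exact Or.inl ((WalkIn.of_adj (U := W \ X) hac ⟨hU ha, haX⟩ ih.left_mem).trans ih)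
    · by_cases hcX : c ∈ X
      · exact Or.inr ⟨c, hcX, .of_adj hac haa ⟨hc.left_mem, Or.inl hcX⟩⟩
      · have hstep : WalkIn G (W \ X) a c :=
          .of_adj hac ⟨hU ha, haX⟩ ⟨hU hc.left_mem, hcX⟩
        refine Or.inr ⟨t, ht, WalkIn.trans (.of_adj hac haa ⟨hc.left_mem, Or.inr hstep⟩)
          (ih.mono ?_)⟩
        rintro r ⟨hr, hr' | hr'⟩
        · exact ⟨hr, Or.inl hr'⟩
        · exact ⟨hr, Or.inr (hstep.trans hr')⟩

theorem TwoConnected.symm (h : TwoConnected G W A B) : TwoConnected G W B A := fun z => by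
  obtain ⟨s, hs, t, ht, h⟩ := h z
  exact ⟨t, ht, s, hs, h.symm⟩

/-- The side of `A` of a separator `X`. -/
theorem TwoConnected.side (h : TwoConnected G W A B)
    (hX : ∀ s ∈ A, ∀ t ∈ B, ¬ WalkIn G (W \ X) s t) :
    TwoConnected G (W ∩ (X ∪ {r | ∃ s ∈ A, WalkIn G (W \ X) s r})) A X := by
  intro z
  obtain ⟨s, hs, t, ht, hst⟩ := h z
  obtain ⟨t', ht', h'⟩ := (hst.exists_hit Set.sdiff_subset X).resolve_left (hX s hs t ht)
  refine ⟨s, hs, t', ht', h'.mono ?_⟩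
  rintro r ⟨hr, hr'⟩
  exact ⟨⟨hr.1, hr'.imp id fun h => ⟨s, hs, h⟩⟩, hr.2⟩

/-- Base case of the Menger argument. A walk from `A` to `B` inside `A ∪ B` contains a link: a
vertex of `A ∩ B`, or an edge from `A` to `B`. It remains to find two disjoint links when no single
vertex meets all of them. -/
theorem twoLinked_of_subset (hW : W ⊆ A ∪ B) [Nonempty V] (h : TwoConnected G W A B) :
    TwoLinked G W A B := by
  have link : ∀ z, ∃ s ∈ A, ∃ t ∈ B, s ∈ W ∧ t ∈ W ∧ s ≠ z ∧ t ≠ z ∧ WalkIn G {s, t} s t := by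
    intro z
    obtain ⟨s, hs, t, ht, hst⟩ := h z
    refine hst.head_induction (P := fun s => s ∈ A → ∃ s ∈ A, ∃ t ∈ B,
      s ∈ W ∧ t ∈ W ∧ s ≠ z ∧ t ≠ z ∧ WalkIn G {s, t} s t) ?_ ?_ hs
    · intro htA
      exact ⟨t, htA, t, ht, hst.right_mem.1, hst.right_mem.1, hst.right_mem.2, hst.right_mem.2,
        .refl (by simp)⟩
    · intro a c hac ha hc ih haA
      rcases hW hc.left_mem.1 with hcA | hcB
      · exact ih hcA
      · exact ⟨a, haA, c, hcB, ha.1, hc.left_mem.1, ha.2, hc.left_mem.2,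
          .of_adj hac (by simp) (by simp)⟩
  by_contra hcon
  let IsLink : V → V → Prop := fun s t => s ∈ A ∧ t ∈ B ∧ s ∈ W ∧ t ∈ W ∧ WalkIn G {s, t} s t
  have fin : ∀ {s t s' t'}, IsLink s t → IsLink s' t' →
      s ≠ s' → s ≠ t' → t ≠ s' → t ≠ t' → False := by
    rintro s t s' t' ⟨h1, h2, h3, h4, h5⟩ ⟨h1', h2', h3', h4', h5'⟩ n1 n2 n3 n4
    refine hcon ⟨{s, t}, {s', t'}, ?_, ?_, ?_, ⟨s, h1, t, h2, h5⟩, s', h1', t', h2', h5'⟩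
    · rintro w (rfl | rfl) <;> assumption
    · rintro w (rfl | rfl) <;> assumption
    · rw [Set.disjoint_left]
      rintro w (rfl | rfl) (rfl | rfl) <;> contradiction
  have pt : ∀ {s}, s ∈ A → s ∈ B → s ∈ W → IsLink s s :=
    fun h h' h'' => ⟨h, h', h'', h'', .refl (by simp)⟩
  -- The second link avoids one end of the first link and the third link avoids the other end. If
  -- both meet the first link, then the second and third are disjoint, or some end lies in `A ∩ B`
  -- and forms a link by itself.
  obtain ⟨s₁, hs₁, t₁, ht₁, w₁, w₁', -, -, h₁⟩ := link (Classical.arbitrary V)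
  obtain ⟨s₂, hs₂, t₂, ht₂, w₂, w₂', n₂, n₂', h₂⟩ := link s₁
  obtain ⟨s₃, hs₃, t₃, ht₃, w₃, w₃', n₃, n₃', h₃⟩ := link t₁
  have l₁ : IsLink s₁ t₁ := ⟨hs₁, ht₁, w₁, w₁', h₁⟩
  have l₂ : IsLink s₂ t₂ := ⟨hs₂, ht₂, w₂, w₂', h₂⟩
  have l₃ : IsLink s₃ t₃ := ⟨hs₃, ht₃, w₃, w₃', h₃⟩
  have c₂ : t₁ = s₂ ∨ t₁ = t₂ := by
    by_contra hc
    rw [not_or] at hc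
    exact fin l₁ l₂ n₂.symm n₂'.symm hc.1 hc.2
  have c₃ : s₁ = s₃ ∨ s₁ = t₃ := by
    by_contra hc
    rw [not_or] at hc
    exact fin l₁ l₃ hc.1 hc.2 n₃.symm n₃'.symm
  rcases c₂ with rfl | rfl <;> rcases c₃ with rfl | rfl
  · by_cases e : t₂ = t₃
    · subst e
      exact fin (pt hs₂ ht₁ w₂) l₃ n₂ n₃'.symm n₂ n₃'.symm
    · exact fin l₂ l₃ n₂ n₃'.symm n₂' e
  · exact fin (pt hs₂ ht₁ w₂) (pt hs₁ ht₃ w₁) n₂ n₂ n₂ n₂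
  · by_cases e : s₂ = t₃
    · subst e
      exact fin (pt hs₂ ht₃ w₂) l₁ n₂ n₃' n₂ n₃'
    · exact fin l₂ l₃ n₂ e n₂' n₃'.symm
  · exact fin (pt hs₁ ht₃ w₁) l₂ n₂.symm n₂'.symm n₂.symm n₂'.symm

/-- If no single vertex meets all walks between `A` and `B`, then there are two disjoint walks
between `A` and `B`. -/
theorem TwoConnected.twoLinked [Finite V] [Nonempty V] (h : TwoConnected G W A B) :
    TwoLinked G W A B := by
  induction hn : W.ncard using Nat.strong_induction_on generalizing W A B with
  | _ n ih =>
  subst hn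
  have smaller : ∀ {W' : Set V} {w : V}, W' ⊆ W → w ∈ W → w ∉ W' → W'.ncard < W.ncard :=
    fun hW' hw hw' => Set.ncard_lt_ncard ⟨hW', fun h => hw' (h hw)⟩ (Set.toFinite _)
  by_cases hW : W ⊆ A ∪ B
  · exact twoLinked_of_subset hW h
  rw [Set.not_subset] at hW
  obtain ⟨x, hxW, hx⟩ := hW
  rw [Set.mem_union, not_or] at hx
  -- Either `x` is superfluous and can be dropped, or some `y` completes it to a separator `{x, y}`
  -- of `A` and `B`. In the second case, linking `A` to `{x, y}` and `B` to `{x, y}` are smaller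
  -- problems.
  by_cases hdel : TwoConnected G (W \ {x}) A B
  · exact (ih _ (smaller Set.sdiff_subset hxW (by simp)) hdel rfl).mono Set.sdiff_subset
  · rw [TwoConnected] at hdel
    push Not at hdel
    obtain ⟨y, hy⟩ := hdel
    rw [Set.sdiff_sdiff, Set.singleton_union] at hy
    obtain ⟨s, hs, t, ht, hst⟩ := h y
    have hsX : s ∉ ({x, y} : Set V) := by
      rintro (rfl | h)
      · exact hx.1 hs
      · exact hst.left_mem.2 h
    have htX : t ∉ ({x, y} : Set V) := by
      rintro (rfl | h)
      · exact hx.2 ht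
      · exact hst.right_mem.2 h
    have hy' : ∀ t ∈ B, ∀ s ∈ A, ¬ WalkIn G (W \ {x, y}) t s := fun t ht s hs h =>
      hy s hs t ht h.symm
    -- The side of `A` is smaller because it misses a vertex `t` of `B`: by `y ≠ t` and `x ∉ B`,
    -- this `t` is outside the separator. The side of `B` misses `s` in the same way.
    have h1 := ih _ (smaller Set.inter_subset_left hst.right_mem.1 (by
      rintro ⟨-, h' | ⟨s', hs', h'⟩⟩
      · exact htX h'
      · exact hy _ hs' _ ht h')) (h.side hy) rfl
    have h2 := ih _ (smaller Set.inter_subset_left hst.left_mem.1 (by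
      rintro ⟨-, h' | ⟨t', ht', h'⟩⟩
      · exact hsX h'
      · exact hy' _ ht' _ hs h')) (h.symm.side hy') rfl
    obtain ⟨C, C', hC, hC', hCC, ⟨a, ha, p, hp, hap⟩, a', ha', p', hp', hap'⟩ := h1
    obtain ⟨D, D', hD, hD', hDD, ⟨b, hb, q, hq, hbq⟩, b', hb', q', hq', hbq'⟩ := h2
    have pair : ∀ {p p' q : V}, p ∈ ({x, y} : Set V) → p' ∈ ({x, y} : Set V) →
        q ∈ ({x, y} : Set V) → p ≠ p' → q = p ∨ q = p' := by
      rintro p p' q (rfl | rfl) (rfl | rfl) (rfl | rfl) h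
      all_goals first | exact absurd rfl h | exact Or.inl rfl | exact Or.inr rfl
    have glue : ∀ {C C' D D' : Set V} {a a' b b' p p' : V},
        C ⊆ W ∩ ({x, y} ∪ {r | ∃ s ∈ A, WalkIn G (W \ {x, y}) s r}) →
        C' ⊆ W ∩ ({x, y} ∪ {r | ∃ s ∈ A, WalkIn G (W \ {x, y}) s r}) →
        D ⊆ W ∩ ({x, y} ∪ {r | ∃ s ∈ B, WalkIn G (W \ {x, y}) s r}) →
        D' ⊆ W ∩ ({x, y} ∪ {r | ∃ s ∈ B, WalkIn G (W \ {x, y}) s r}) →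
        Disjoint C C' → Disjoint D D' → a ∈ A → a' ∈ A → b ∈ B → b' ∈ B →
        p ∈ ({x, y} : Set V) → p' ∈ ({x, y} : Set V) → WalkIn G C a p → WalkIn G C' a' p' →
        WalkIn G D b p → WalkIn G D' b' p' → TwoLinked G W A B := by
      intro C C' D D' a a' b b' p p' hC hC' hD hD' hCC hDD ha ha' hb hb' hp hp' h1 h2 h3 h4
      rw [Set.disjoint_left] at hCC hDD
      -- The two sides meet only in the separator, so walks from different sides can collide only at
      -- `p` or `p'`.
      have cross : ∀ w, w ∈ W ∩ ({x, y} ∪ {r | ∃ s ∈ A, WalkIn G (W \ {x, y}) s r}) →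
          w ∈ W ∩ ({x, y} ∪ {r | ∃ s ∈ B, WalkIn G (W \ {x, y}) s r}) → w = p ∨ w = p' := by
        rintro w ⟨-, hw⟩ ⟨-, hw'⟩
        have hpp : p ≠ p' := fun e => hCC h1.right_mem (e ▸ h2.right_mem)
        have hwX : w ∈ ({x, y} : Set V) := by
          rcases hw with hw | ⟨s, hs, hw⟩
          · exact hw
          · rcases hw' with hw' | ⟨t, ht, hw'⟩
            · exact hw'
            · exact absurd (hw.trans hw'.symm) (hy s hs t ht)
        exact pair hp hp' hwX hpp
      refine ⟨C ∪ D, C' ∪ D', Set.union_subset (fun w hw => (hC hw).1) fun w hw => (hD hw).1,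
        Set.union_subset (fun w hw => (hC' hw).1) fun w hw => (hD' hw).1, ?_,
        ⟨a, ha, b, hb, (h1.mono Set.subset_union_left).trans
          (h3.symm.mono Set.subset_union_right)⟩,
        a', ha', b', hb', (h2.mono Set.subset_union_left).trans
          (h4.symm.mono Set.subset_union_right)⟩
      rw [Set.disjoint_left]
      have m1 := h1.right_mem
      have m2 := h2.right_mem
      have m3 := h3.right_mem
      have m4 := h4.right_mem
      rintro w (hw | hw) (hw' | hw')
      · exact hCC hw hw'
      · rcases cross w (hC hw) (hD' hw') with rfl | rfl
        · exact hDD m3 hw'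
        · exact hCC hw m2
      · rcases cross w (hC' hw') (hD hw) with rfl | rfl
        · exact hCC m1 hw'
        · exact hDD hw m4
      · exact hDD hw hw'
    -- On either side the two disjoint walks end in different vertices of `{x, y}`, so the ends
    -- match up, possibly after swapping the walks on one side.
    by_cases hpq : p = q
    · subst hpq
      have : p' = q' := by
        have e1 : p ≠ p' := fun e => Set.disjoint_left.1 hCC hap.right_mem (e ▸ hap'.right_mem)
        have e2 : p ≠ q' := fun e => Set.disjoint_left.1 hDD hbq.right_mem (e ▸ hbq'.right_mem)
        exact ((pair hp hp' hq' e1).resolve_left e2.symm).symm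
      subst this
      exact glue hC hC' hD hD' hCC hDD ha ha' hb hb' hp hp' hap hap' hbq hbq'
    · have e1 : p ≠ p' := fun e => Set.disjoint_left.1 hCC hap.right_mem (e ▸ hap'.right_mem)
      have e2 : q ≠ q' := fun e => Set.disjoint_left.1 hDD hbq.right_mem (e ▸ hbq'.right_mem)
      obtain rfl := (pair hp hp' hq e1).resolve_left (Ne.symm hpq)
      obtain rfl := (pair hp hp' hq' e1).resolve_right e2.symm
      exact glue hC hC' hD' hD hCC hDD.symm ha ha' hb' hb hp hp' hap hap' hbq' hbq

end Menger

/-! ### 3-connected separating pairs -/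

section SeparatingPairs

variable {V : Type} {G : SimpleGraph V} {B U : Set V} {u v x y a b : V}

/-- Walks between vertices of a biconnected component can be kept inside the component. -/
theorem IsBiconnComp.walkIn_inter (hB : IsBiconnComp G Set.univ B) (ha : a ∈ B) (hb : b ∈ B)
    (h : WalkIn G U a b) : WalkIn G (B ∩ U) a b := by
  by_cases hab : a = b
  · subst hab
    exact .refl ⟨ha, h.left_mem⟩
  · obtain ⟨-, rfl⟩ := (isBiconnComp_univ_iff_of_ne ha hb hab).1 hB
    exact h.inter_block ha hb

/-- This makes separation inside `B` expressible by avoiding reachability in the whole graph, which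
is all that the program stores. -/
theorem IsBiconnComp.walkIn_diff_iff (hB : IsBiconnComp G Set.univ B) (ha : a ∈ B) (hb : b ∈ B)
    {X : Set V} : WalkIn G (B \ X) a b ↔ WalkIn G Xᶜ a b :=
  ⟨fun h => h.mono fun _ h => h.2, fun h => hB.walkIn_inter ha hb h⟩

theorem exists_path_of_walkIn {C : Set V} {s t : V} (hu : u ∉ C) (hv : v ∉ C) (huv : u ≠ v)
    (hus : G.Adj u s) (htv : G.Adj t v) (h : WalkIn G C s t) :
    ∃ p : G.Path u v, (∀ w ∈ p.1.support, w ∈ C ∨ w = u ∨ w = v) ∧ ∃ w ∈ p.1.support, w ∈ C := by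
  classical
  obtain ⟨p, hp⟩ := h
  have hq : ∀ w ∈ p.bypass.support, w ∈ C := fun w hw => hp w (p.support_bypass_subset_support hw)
  have h1 : (p.bypass.concat htv).IsPath :=
    p.bypass_isPath.concat (fun h => hv (hq v h)) htv
  have h2 : u ∉ (p.bypass.concat htv).support := by
    rw [SimpleGraph.Walk.support_concat, List.mem_append,
      List.mem_singleton]
    rintro (h | h)
    · exact hu (hq u h)
    · exact huv h
  refine ⟨⟨.cons hus (p.bypass.concat htv), h1.cons h2⟩, fun w hw => ?_, s, ?_,
    hq s p.bypass.start_mem_support⟩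
  · rw [SimpleGraph.Walk.support_cons, SimpleGraph.Walk.support_concat, List.mem_cons,
      List.mem_append, List.mem_singleton] at hw
    rcases hw with hw | hw | hw
    · exact Or.inr (Or.inl hw)
    · exact Or.inl (hq w hw)
    · exact Or.inr (Or.inr hw)
  · rw [SimpleGraph.Walk.support_cons]
    exact List.mem_cons_of_mem _ (SimpleGraph.Walk.start_mem_support _)

/-- Three paths with disjoint interiors. -/
def HasThreePaths (G : SimpleGraph V) (B : Set V) (u v : V) : Prop :=
  ∃ p : Fin 3 → G.Path u v, Function.Injective p ∧
    (∀ i, ∀ x ∈ (p i).1.support, x ∈ B) ∧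
    ∀ i j, i ≠ j → ∀ x, x ∈ (p i).1.support → x ∈ (p j).1.support → x = u ∨ x = v

/-- Path `0` is exempt from `hm` because it may be the edge `uv`, which has no interior. Of two
different indices at least one has an interior vertex, and this makes the paths distinct. -/
theorem hasThreePaths_of_sets (hu : u ∈ B) (hv : v ∈ B) (p : Fin 3 → G.Path u v)
    (C : Fin 3 → Set V) (hC : ∀ i, C i ⊆ B \ {u, v}) (hd : ∀ i j, i ≠ j → Disjoint (C i) (C j))
    (hp : ∀ i, ∀ w ∈ (p i).1.support, w ∈ C i ∨ w = u ∨ w = v)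
    (hm : ∀ i, i ≠ 0 → ∃ w ∈ (p i).1.support, w ∈ C i) : HasThreePaths G B u v := by
  have hdis : ∀ i j, i ≠ j → ∀ x, x ∈ (p i).1.support → x ∈ (p j).1.support → x = u ∨ x = v := by
    intro i j hij x hx hx'
    rcases hp i x hx with h | h
    · rcases hp j x hx' with h' | h'
      · exact absurd h' (Set.disjoint_left.1 (hd i j hij) h)
      · exact h'
    · exact h
  have hne : ∀ i j, i ≠ j → j ≠ 0 → p i ≠ p j := by
    intro i j hij hj e
    obtain ⟨w, hw, hwC⟩ := hm j hj
    exact (hC j hwC).2 (hdis i j hij w (e ▸ hw) hw)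
  refine ⟨p, fun i j e => ?_, fun i x hx => ?_, hdis⟩
  · by_contra hij
    by_cases hj : j = 0
    · exact hne j i (Ne.symm hij) (fun hi => hij (hi.trans hj.symm)) e.symm
    · exact hne i j hij hj e
  · rcases hp i x hx with h | rfl | rfl
    · exact (hC i h).1
    · exact hu
    · exact hv

/-- The connected component of `x` in `G[B] - {u, v}`. -/
def sideOf (G : SimpleGraph V) (B : Set V) (u v x : V) : Set V := {w | WalkIn G (B \ {u, v}) x w}

theorem sideOf_subset : sideOf G B u v x ⊆ B \ {u, v} := fun _ h => WalkIn.right_mem h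

theorem sideOf_disjoint (h : y ∉ sideOf G B u v x) :
    Disjoint (sideOf G B u v x) (sideOf G B u v y) := by
  rw [Set.disjoint_left]
  intro w hw hw'
  exact h (WalkIn.trans hw (WalkIn.symm hw'))

theorem walkIn_sideOf {s t : V} {K : Set V} (hK : K ⊆ B \ {u, v}) (hs : s ∈ sideOf G B u v x)
    (h : WalkIn G K s t) : WalkIn G (sideOf G B u v x ∩ K) s t :=
  h.restrict.mono fun _ hw => ⟨WalkIn.trans hs (WalkIn.mono hw hK), WalkIn.right_mem hw⟩

/-- Every component of `G[B] - {u, v}` is attached to both `u` and `v`. -/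
theorem BiconnOn.exists_attached (hB : BiconnOn G B) (hu : u ∈ B) (hv : v ∈ B) (huv : u ≠ v)
    (hx : x ∈ B \ {u, v}) : ∃ s t, G.Adj u s ∧ G.Adj t v ∧ WalkIn G (sideOf G B u v x) s t := by
  rw [biconnOn_iff] at hB
  have hxu : x ≠ u := fun h => hx.2 (Or.inl h)
  have hxv : x ≠ v := fun h => hx.2 (Or.inr h)
  obtain ⟨s, hs, h1⟩ := (connOn_iff.1 (hB.2 v) x ⟨hx.1, hxv⟩ u ⟨hu, huv⟩).exists_adj_end hxu
  obtain ⟨t, ht, h2⟩ := (connOn_iff.1 (hB.2 u) x ⟨hx.1, hxu⟩ v ⟨hv, huv.symm⟩).exists_adj_end hxv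
  have e1 : (B \ {v}) \ {u} ⊆ B \ {u, v} := fun w hw => ⟨hw.1.1, by
    rintro (rfl | h)
    exacts [hw.2 rfl, hw.1.2 h]⟩
  have e2 : (B \ {u}) \ {v} ⊆ B \ {u, v} := fun w hw => ⟨hw.1.1, by
    rintro (h | h)
    exacts [hw.1.2 h, hw.2 h]⟩
  have h3 := h1.mono e1
  exact ⟨s, t, hs.symm, ht, (walkIn_sideOf subset_rfl h3 (h3.symm.trans (h2.mono e2))).mono
    Set.inter_subset_left⟩

theorem hasThreePaths_of_walks (hu : u ∈ B) (hv : v ∈ B) (huv : u ≠ v) (C : Fin 3 → Set V)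
    (hC : ∀ i, C i ⊆ B \ {u, v}) (hd : ∀ i j, i ≠ j → Disjoint (C i) (C j))
    (h : ∀ i, (∃ s t, G.Adj u s ∧ G.Adj t v ∧ WalkIn G (C i) s t) ∨ i = 0 ∧ G.Adj u v) :
    HasThreePaths G B u v := by
  have key : ∀ i, ∃ p : G.Path u v, (∀ w ∈ p.1.support, w ∈ C i ∨ w = u ∨ w = v) ∧
      (i ≠ 0 → ∃ w ∈ p.1.support, w ∈ C i) := by
    intro i
    rcases h i with ⟨s, t, hs, ht, hst⟩ | ⟨hi, hadj⟩
    · obtain ⟨p, hp, hp'⟩ := exists_path_of_walkIn (fun h => (hC i h).2 (Or.inl rfl))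
        (fun h => (hC i h).2 (Or.inr rfl)) huv hs ht hst
      exact ⟨p, hp, fun _ => hp'⟩
    · exact ⟨.singleton hadj, fun w hw => Or.inr (by simpa using hw), fun h => absurd hi h⟩
  choose p hp hm using key
  exact hasThreePaths_of_sets hu hv p C hC hd hp hm

theorem hasThreePaths_of_disjoint {C₀ C₁ C₂ : Set V} (hu : u ∈ B) (hv : v ∈ B) (huv : u ≠ v)
    (h₀ : C₀ ⊆ B \ {u, v}) (h₁ : C₁ ⊆ B \ {u, v}) (h₂ : C₂ ⊆ B \ {u, v})
    (d₀ : Disjoint C₀ C₁) (d₁ : Disjoint C₀ C₂) (d₂ : Disjoint C₁ C₂)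
    (w₀ : (∃ s t, G.Adj u s ∧ G.Adj t v ∧ WalkIn G C₀ s t) ∨ G.Adj u v)
    (w₁ : ∃ s t, G.Adj u s ∧ G.Adj t v ∧ WalkIn G C₁ s t)
    (w₂ : ∃ s t, G.Adj u s ∧ G.Adj t v ∧ WalkIn G C₂ s t) : HasThreePaths G B u v := by
  refine hasThreePaths_of_walks hu hv huv ![C₀, C₁, C₂] ?_ ?_ ?_
  · simpa [Fin.forall_fin_succ] using ⟨h₀, h₁, h₂⟩
  · simpa [Fin.forall_fin_succ] using ⟨⟨d₀, d₁⟩, ⟨d₀.symm, d₂⟩, d₁.symm, d₂.symm⟩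
  · intro i
    fin_cases i
    · exact w₀.imp id fun h => ⟨rfl, h⟩
    · exact Or.inl w₁
    · exact Or.inl w₂

/-- Two paths run through the component of `x`, and the third through the component of `y`. -/
theorem hasThreePaths_of_twoLinked (hB : BiconnOn G B) (hu : u ∈ B) (hv : v ∈ B) (huv : u ≠ v)
    (hy : y ∈ B \ {u, v}) (hxy : Disjoint (sideOf G B u v x) (sideOf G B u v y))
    (h : TwoLinked G (sideOf G B u v x) {s | G.Adj u s} {t | G.Adj t v}) :
    HasThreePaths G B u v := by
  obtain ⟨C, C', hC, hC', hCC, ⟨s, hs, t, ht, h1⟩, s', hs', t', ht', h2⟩ := h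
  exact hasThreePaths_of_disjoint hu hv huv (hC.trans sideOf_subset) (hC'.trans sideOf_subset)
    sideOf_subset hCC (hxy.mono_left hC) (hxy.mono_left hC') (Or.inl ⟨s, t, hs, ht, h1⟩)
    ⟨s', t', hs', ht', h2⟩ (hB.exists_attached hu hv huv hy)

/-- A component of `G[B] - {u, v}` in which `u` and `v` are not linked by two disjoint walks has a
vertex that meets all of these walks. -/
theorem exists_cut_of_not_twoLinked [Finite V] (hB : BiconnOn G B) (hu : u ∈ B) (hv : v ∈ B)
    (huv : u ≠ v) (hx : x ∈ B \ {u, v})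
    (h : ¬ TwoLinked G (sideOf G B u v x) {s | G.Adj u s} {t | G.Adj t v}) :
    ∃ a, a ≠ u ∧ a ≠ v ∧ ∀ s t, G.Adj u s → G.Adj t v →
      ¬ WalkIn G (sideOf G B u v x \ {a}) s t := by
  have : Nonempty V := ⟨u⟩
  have h' := mt TwoConnected.twoLinked h
  rw [TwoConnected] at h'
  push Not at h'
  obtain ⟨a, ha⟩ := h'
  obtain ⟨s, t, hs, ht, hst⟩ := hB.exists_attached hu hv huv hx
  -- A vertex outside the component cannot meet the walk provided by `BiconnOn.exists_attached`.
  -- Membership in the component also gives `a ≠ u` and `a ≠ v`.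
  have haS : a ∈ sideOf G B u v x := by
    by_contra haS
    exact ha s hs t ht (by rwa [Set.sdiff_singleton_eq_self haS])
  have := sideOf_subset haS
  exact ⟨a, fun h => this.2 (Or.inl h), fun h => this.2 (Or.inr h),
    fun s t hs ht => ha s hs t ht⟩

/-- For a separating pair of a biconnected component, the existence of three disjoint paths is
expressed by reachability that avoids two vertices. -/
theorem IsBiconnComp.hasThreePaths_iff [Finite V] (hB : IsBiconnComp G Set.univ B) (hu : u ∈ B)
    (hv : v ∈ B) (huv : u ≠ v) (hx : x ∈ B \ {u, v}) (hy : y ∈ B \ {u, v})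
    (hxy : ¬ WalkIn G (B \ {u, v}) x y) : HasThreePaths G B u v ↔
      G.Adj u v ∨ ∀ a b, a ≠ u → a ≠ v → b ≠ u → b ≠ v → WalkIn G {a, b}ᶜ u v := by
  have hbi := hB.prop.2
  have hdis : Disjoint (sideOf G B u v x) (sideOf G B u v y) := sideOf_disjoint hxy
  constructor
  · rintro ⟨p, -, -, hd⟩
    refine Or.inr fun a b hau hav hbu hbv => ?_
    have ha : ∀ i j, i ≠ j → a ∈ (p i).1.support → a ∈ (p j).1.support → False :=
      fun i j hij h h' => (hd i j hij a h h').elim hau hav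
    have hb : ∀ i j, i ≠ j → b ∈ (p i).1.support → b ∈ (p j).1.support → False :=
      fun i j hij h h' => (hd i j hij b h h').elim hbu hbv
    -- Each of `a` and `b` lies on at most one of the three paths, so one path avoids both.
    obtain ⟨i, hi⟩ : ∃ i, ¬ (a ∈ (p i).1.support ∨ b ∈ (p i).1.support) := by
      by_contra hcon
      push Not at hcon
      have h01 : (0 : Fin 3) ≠ 1 := by decide
      have h02 : (0 : Fin 3) ≠ 2 := by decide
      have h12 : (1 : Fin 3) ≠ 2 := by decide
      rcases hcon 0 with h0 | h0 <;> rcases hcon 1 with h1 | h1 <;> rcases hcon 2 with h2 | h2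
      · exact ha 0 1 h01 h0 h1
      · exact ha 0 1 h01 h0 h1
      · exact ha 0 2 h02 h0 h2
      · exact hb 1 2 h12 h1 h2
      · exact ha 1 2 h12 h1 h2
      · exact hb 0 2 h02 h0 h2
      · exact hb 0 1 h01 h0 h1
      · exact hb 0 1 h01 h0 h1
    rw [not_or] at hi
    refine ⟨(p i).1, fun w hw => ?_⟩
    rintro (rfl | rfl)
    · exact hi.1 hw
    · exact hi.2 hw
  · intro h
    by_cases hadj : G.Adj u v
    · exact hasThreePaths_of_disjoint (C₀ := ∅) hu hv huv (Set.empty_subset _) sideOf_subset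
        sideOf_subset (Set.empty_disjoint _) (Set.empty_disjoint _) hdis (Or.inr hadj)
        (hbi.exists_attached hu hv huv hx) (hbi.exists_attached hu hv huv hy)
    replace h := h.resolve_left hadj
    -- Three components of `G[B] - {u, v}` carry one path each.
    by_cases hz : ∃ z ∈ B \ {u, v}, z ∉ sideOf G B u v x ∧ z ∉ sideOf G B u v y
    · obtain ⟨z, hz, hzx, hzy⟩ := hz
      exact hasThreePaths_of_disjoint hu hv huv sideOf_subset sideOf_subset sideOf_subset hdis
        (sideOf_disjoint hzx) (sideOf_disjoint hzy)
        (Or.inl (hbi.exists_attached hu hv huv hx)) (hbi.exists_attached hu hv huv hy)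
        (hbi.exists_attached hu hv huv hz)
    by_contra hno
    -- With exactly two components and no three paths, neither component links `u` and `v` twice.
    -- Each is then cut by one vertex, and these two vertices together will separate `u` from `v`.
    obtain ⟨a, hau, hav, ha⟩ := exists_cut_of_not_twoLinked hbi hu hv huv hx
      (mt (hasThreePaths_of_twoLinked hbi hu hv huv hy hdis) hno)
    obtain ⟨b, hbu, hbv, hb⟩ := exists_cut_of_not_twoLinked hbi hu hv huv hy
      (mt (hasThreePaths_of_twoLinked hbi hu hv huv hx hdis.symm) hno)
    -- A walk from `u` to `v` that avoids `a` and `b` is stripped of both ends. As `u` and `v` are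
    -- not adjacent, an inner walk in `B \ {u, v}` remains; it stays in one component and
    -- contradicts the cut vertex there.
    obtain ⟨t, ht, h1⟩ := (hB.walkIn_inter hu hv (h a b hau hav hbu hbv)).exists_adj_end huv
    have htu : t ≠ u := by
      rintro rfl
      exact hadj ht
    obtain ⟨s, hs, h2⟩ := h1.symm.exists_adj_end htu
    set K := ((B ∩ {a, b}ᶜ) \ {v}) \ {u} with hK
    have hKB : K ⊆ B \ {u, v} := fun w hw => ⟨hw.1.1.1, by
      rintro (h | h)
      exacts [hw.2 h, hw.1.2 h]⟩
    have hKa : ∀ w ∈ K, w ∉ ({a} : Set V) := fun w hw h => hw.1.1.2 (Or.inl h)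
    have hKb : ∀ w ∈ K, w ∉ ({b} : Set V) := fun w hw h => hw.1.1.2 (Or.inr h)
    have hside : t ∈ sideOf G B u v x ∨ t ∈ sideOf G B u v y := by
      by_contra hcon
      rw [not_or] at hcon
      exact hz ⟨t, hKB h2.left_mem, hcon⟩
    rcases hside with htx | hty
    · exact ha s t hs.symm ht ((walkIn_sideOf hKB htx h2).mono
        (U' := sideOf G B u v x \ {a}) fun w hw => ⟨hw.1, hKa w hw.2⟩).symm
    · exact hb s t hs.symm ht ((walkIn_sideOf hKB hty h2).mono
        (U' := sideOf G B u v y \ {b}) fun w hw => ⟨hw.1, hKb w hw.2⟩).symm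

/-- A description of 3-connected separating pairs by avoiding reachability. -/
def IsSepPair (G : SimpleGraph V) (B : Set V) (u v : V) : Prop :=
  u ∈ B ∧ v ∈ B ∧ u ≠ v ∧
    (∃ x y, x ∈ B ∧ y ∈ B ∧ (x ≠ u ∧ x ≠ v) ∧ (y ≠ u ∧ y ≠ v) ∧ ¬ WalkIn G {u, v}ᶜ x y) ∧
    (G.Adj u v ∨ ∀ a b, a ≠ u → a ≠ v → b ≠ u → b ≠ v → WalkIn G {a, b}ᶜ u v)

theorem IsBiconnComp.isThreeConnSepPair_iff [Finite V] (hB : IsBiconnComp G Set.univ B) :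
    IsThreeConnSepPair G B u v ↔ IsSepPair G B u v := by
  refine and_congr_right fun hu => and_congr_right fun hv => and_congr_right fun huv => ?_
  have hmem : ∀ x, x ∈ B \ {u, v} ↔ x ∈ B ∧ x ≠ u ∧ x ≠ v := fun x => by simp
  constructor
  · rintro ⟨h1, h2⟩
    rw [connOn_iff] at h1
    push Not at h1
    obtain ⟨x, hx, y, hy, hxy⟩ := h1
    refine ⟨⟨x, y, hx.1, hy.1, ((hmem x).1 hx).2, ((hmem y).1 hy).2, ?_⟩,
      (hB.hasThreePaths_iff hu hv huv hx hy hxy).1 h2⟩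
    rwa [← hB.walkIn_diff_iff hx.1 hy.1]
  · rintro ⟨⟨x, y, hxB, hyB, hx, hy, hxy⟩, h2⟩
    have hx' := (hmem x).2 ⟨hxB, hx⟩
    have hy' := (hmem y).2 ⟨hyB, hy⟩
    rw [← hB.walkIn_diff_iff hxB hyB] at hxy
    exact ⟨fun h => hxy (connOn_iff.1 h x hx' y hy'),
      (hB.hasThreePaths_iff hu hv huv hx' hy' hxy).2 h2⟩

/-! ### Triconnected components -/

/-- No 3-connected separating pair separates `x` from `y`. -/
def PairUnseparated (G : SimpleGraph V) (B : Set V) (x y : V) : Prop :=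
  ∀ u v, IsSepPair G B u v → x ≠ u ∧ x ≠ v → y ≠ u ∧ y ≠ v → WalkIn G {u, v}ᶜ x y

theorem PairUnseparated.refl : PairUnseparated G B x x := fun _ _ _ hx _ => .refl (by simp [hx])

theorem PairUnseparated.symm (h : PairUnseparated G B x y) : PairUnseparated G B y x :=
  fun u v huv hy hx => (h u v huv hx hy).symm

/-- The defining condition of triconnected components concerns only pairs of vertices, so these
components are the maximal cliques of `PairUnseparated` in `B`. -/
theorem IsBiconnComp.notSeparated_iff [Finite V] (hB : IsBiconnComp G Set.univ B) (hU : U ⊆ B) :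
    NotSeparated G B U ↔ ∀ x ∈ U, ∀ y ∈ U, PairUnseparated G B x y := by
  constructor
  · intro h x hx y hy u v huv hxu hyu
    have hx' : x ∈ B \ {u, v} := ⟨hU hx, by simpa using hxu⟩
    have hy' : y ∈ B \ {u, v} := ⟨hU hy, by simpa using hyu⟩
    have h' := h u v (hB.isThreeConnSepPair_iff.2 huv) ⟨x, hx'⟩ ⟨y, hy'⟩ hx hy
    exact ((reachable_induce_iff hx' hy').1 h').mono fun _ h => h.2
  · rintro h u v huv ⟨x, hx⟩ ⟨y, hy⟩ hxU hyU
    rw [reachable_induce_iff, hB.walkIn_diff_iff hx.1 hy.1]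
    exact h x hxU y hyU u v (hB.isThreeConnSepPair_iff.1 huv) (by simpa using hx.2)
      (by simpa using hy.2)

/-- The vertices of `B` that are separated from none of `a`, `b`, `c`. -/
def triBlock (G : SimpleGraph V) (B : Set V) (a b c : V) : Set V :=
  {t | t ∈ B ∧ PairUnseparated G B t a ∧ PairUnseparated G B t b ∧ PairUnseparated G B t c}

/-- The tuple `a, b, c` names a triconnected component. -/
def NamesTriBlock (G : SimpleGraph V) (B : Set V) (a b c : V) : Prop :=
  (a ∈ triBlock G B a b c ∧ b ∈ triBlock G B a b c ∧ c ∈ triBlock G B a b c) ∧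
    ∀ s t, s ∈ triBlock G B a b c → t ∈ triBlock G B a b c → PairUnseparated G B s t

/-- Sets with fewer than three vertices are listed with repetitions, so that names always have the
same length. -/
theorem exists_three_mem (h : U.Nonempty) : ∃ a ∈ U, ∃ b ∈ U, ∃ c ∈ U,
    U ⊆ {a, b, c} ∨ a ≠ b ∧ a ≠ c ∧ b ≠ c := by
  obtain ⟨a, ha⟩ := h
  by_cases h1 : U ⊆ {a}
  · exact ⟨a, ha, a, ha, a, ha, Or.inl (by simpa using h1)⟩
  obtain ⟨b, hb, hab⟩ := Set.not_subset.1 h1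
  by_cases h2 : U ⊆ {a, b}
  · exact ⟨a, ha, b, hb, b, hb, Or.inl (by simpa using h2)⟩
  obtain ⟨c, hc, habc⟩ := Set.not_subset.1 h2
  refine ⟨a, ha, b, hb, c, hc, Or.inr ⟨fun h => hab h.symm, fun h => habc (Or.inl h.symm),
    fun h => habc (Or.inr h.symm)⟩⟩

/-- `PairUnseparated` is not transitive in general, since the middle vertex may belong to the
separating pair. Three distinct intermediate vertices repair this: one of them is always outside the
pair. Hence whatever is unseparated from `a`, `b`, `c` is unseparated from all of `U`, and belongs
to `U` by maximality. -/
theorem IsBiconnComp.isTriconnComp_iff [Finite V] (hB : IsBiconnComp G Set.univ B)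
    (hne : B.Nonempty) : IsTriconnComp G B U ↔
      ∃ a b c, NamesTriBlock G B a b c ∧ U = triBlock G B a b c := by
  constructor
  · intro h
    have hU := h.prop.1
    have hcl := (hB.notSeparated_iff hU).1 h.prop.2
    have hUne : U.Nonempty := by
      by_contra hemp
      rw [Set.not_nonempty_iff_eq_empty] at hemp
      subst hemp
      obtain ⟨x, hx⟩ := hne
      have hx' : {x} ⊆ B := Set.singleton_subset_iff.2 hx
      refine h.le_of_ge (y := {x}) ⟨hx', (hB.notSeparated_iff hx').2 ?_⟩ (Set.empty_subset _) rfl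
      rintro _ rfl _ rfl
      exact .refl
    obtain ⟨a, ha, b, hb, c, hc, habc⟩ := exists_three_mem hUne
    have hsub : U ⊆ triBlock G B a b c := fun t ht =>
      ⟨hU ht, hcl t ht a ha, hcl t ht b hb, hcl t ht c hc⟩
    have hall : ∀ t ∈ triBlock G B a b c, ∀ r ∈ U, PairUnseparated G B t r := by
      rintro t ⟨-, hta, htb, htc⟩ r hr
      rcases habc with hs | ⟨hab, hac, hbc⟩
      · rcases hs hr with rfl | rfl | rfl <;> assumption
      · intro u v huv htu hru
        -- A pair `{u, v}` cannot contain all three of `a`, `b`, `c`.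
        have h3 : (a ≠ u ∧ a ≠ v) ∨ (b ≠ u ∧ b ≠ v) ∨ (c ≠ u ∧ c ≠ v) := by
          by_contra hcon
          grind
        rcases h3 with h3 | h3 | h3
        · exact (hta u v huv htu h3).trans (hcl a ha r hr u v huv h3 hru)
        · exact (htb u v huv htu h3).trans (hcl b hb r hr u v huv h3 hru)
        · exact (htc u v huv htu h3).trans (hcl c hc r hr u v huv h3 hru)
    have heq : U = triBlock G B a b c := by
      refine Set.Subset.antisymm hsub fun t ht => ?_
      have hins : insert t U ⊆ B := Set.insert_subset ht.1 hU
      refine h.le_of_ge ⟨hins, (hB.notSeparated_iff hins).2 ?_⟩ (Set.subset_insert _ _)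
        (Set.mem_insert _ _)
      rintro x (rfl | hx) y (rfl | hy)
      · exact .refl
      · exact hall _ ht y hy
      · exact (hall _ ht x hx).symm
      · exact hcl x hx y hy
    refine ⟨a, b, c, ⟨?_, ?_⟩, heq⟩
    · rw [← heq]
      exact ⟨ha, hb, hc⟩
    · rw [← heq]
      exact fun s t hs ht => hcl s hs t ht
  · rintro ⟨a, b, c, ⟨⟨ha, hb, hc⟩, hcl⟩, rfl⟩
    have hsub : triBlock G B a b c ⊆ B := fun t ht => ht.1
    refine ⟨⟨hsub, (hB.notSeparated_iff hsub).2 fun x hx y hy => hcl x y hx hy⟩,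
      fun X hX hle t ht => ?_⟩
    have hX' := (hB.notSeparated_iff hX.1).1 hX.2 t ht
    exact ⟨hX.1 ht, hX' a (hle ha), hX' b (hle hb), hX' c (hle hc)⟩

end SeparatingPairs

/-! ### First-order definitions of the ingredients of the trees -/

namespace FOQ

variable {α : Type}

theorem avoid_one (a b c : α) :
    FOQ (fun n G (x : α → Fin n) => WalkIn G {x a}ᶜ (x b) (x c)) :=
  (FOQ.avoid a a b c).congr fun n G x => by rw [Set.pair_eq_singleton]

/-- The basic relation always forbids at least one vertex. Forbidding the target and taking the last
step to it separately recovers plain reachability. -/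
theorem reachable (a b : α) : FOQ (fun n G (x : α → Fin n) => G.Reachable (x a) (x b)) := by
  refine FOQ.congr (Q := fun n G (x : α → Fin n) =>
    x a = x b ∨ ∃ w, G.Adj w (x b) ∧ WalkIn G {x b}ᶜ (x a) w) ((FOQ.eq _ _).or
      (FOQ.ex ((FOQ.adj none (some b)).and (FOQ.avoid_one (some b) (some a) none))))
    fun n G x => ⟨?_, fun h => ?_⟩
  · rintro (h | ⟨w, hw, h⟩)
    · rw [h]
    · exact (WalkIn.univ_iff.1 (h.mono (Set.subset_univ _))).trans hw.reachable
  · by_cases hab : x a = x b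
    · exact Or.inl hab
    · obtain ⟨w, hw, h'⟩ := (WalkIn.univ_iff.2 h).exists_adj_end hab
      exact Or.inr ⟨w, hw, h'.mono fun _ h => h.2⟩

theorem ne_and_ne (a b c : α) : FOQ (fun n _ (x : α → Fin n) => x a ≠ x b ∧ x a ≠ x c) :=
  (FOQ.ne a b).and (FOQ.ne a c)

theorem mem_block (a b c : α) :
    FOQ (fun n G (x : α → Fin n) => x c ∈ block G (x a) (x b)) :=
  FOQ.all ((FOQ.ne _ _).imp ((FOQ.avoid_one _ _ _).or (FOQ.avoid_one _ _ _)))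

theorem unseparated (a b : α) :
    FOQ (fun n G (x : α → Fin n) => Unseparated G (x a) (x b)) :=
  (FOQ.reachable _ _).and (FOQ.all ((FOQ.ne _ _).imp ((FOQ.ne _ _).imp (FOQ.avoid_one _ _ _))))

theorem isolated (a : α) : FOQ (fun n G (x : α → Fin n) => ∀ w, ¬ G.Adj (x a) w) :=
  FOQ.all (FOQ.adj _ _).not

theorem isSepPair (a b u v : α) :
    FOQ (fun n G (x : α → Fin n) => IsSepPair G (block G (x a) (x b)) (x u) (x v)) :=
  (mem_block _ _ _).and ((mem_block _ _ _).and ((FOQ.ne _ _).and ((FOQ.ex (FOQ.ex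
    ((mem_block _ _ _).and ((mem_block _ _ _).and ((ne_and_ne _ _ _).and ((ne_and_ne _ _ _).and
      (FOQ.avoid _ _ _ _).not)))))).and ((FOQ.adj _ _).or (FOQ.all (FOQ.all ((FOQ.ne _ _).imp
        ((FOQ.ne _ _).imp ((FOQ.ne _ _).imp ((FOQ.ne _ _).imp (FOQ.avoid _ _ _ _)))))))))))

theorem pairUnseparated (a b u v : α) :
    FOQ (fun n G (x : α → Fin n) => PairUnseparated G (block G (x a) (x b)) (x u) (x v)) :=
  FOQ.all (FOQ.all ((isSepPair _ _ _ _).imp ((ne_and_ne _ _ _).imp ((ne_and_ne _ _ _).imp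
    (FOQ.avoid _ _ _ _)))))

theorem mem_triBlock (a b c d e t : α) : FOQ (fun n G (x : α → Fin n) =>
    x t ∈ triBlock G (block G (x a) (x b)) (x c) (x d) (x e)) :=
  (mem_block _ _ _).and ((pairUnseparated _ _ _ _).and ((pairUnseparated _ _ _ _).and
    (pairUnseparated _ _ _ _)))

theorem namesTriBlock (a b c d e : α) : FOQ (fun n G (x : α → Fin n) =>
    NamesTriBlock G (block G (x a) (x b)) (x c) (x d) (x e)) :=
  ((mem_triBlock _ _ _ _ _ _).and ((mem_triBlock _ _ _ _ _ _).and
    (mem_triBlock _ _ _ _ _ _))).and (FOQ.all (FOQ.all ((mem_triBlock _ _ _ _ _ _).imp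
      ((mem_triBlock _ _ _ _ _ _).imp (pairUnseparated _ _ _ _)))))

end FOQ

/-! ### Storing decomposition trees -/

section Storing

theorem decompositionTree_adj_comp_sep {V : Type} {𝒞 : Set (GraphIn V)} {𝒮 : Set (Set V)}
    {K : GraphIn V} {S : Set V} (hK : K ∈ 𝒞) (hS : S ∈ 𝒮) :
    (decompositionTree 𝒞 𝒮).Adj (.comp K) (.sep S) ↔ S ⊆ K.verts := by
  constructor
  · rintro ⟨K', -, S', -, h, ⟨h1, h2⟩ | ⟨h1, -⟩⟩
    · cases h1
      cases h2
      exact h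
    · cases h1
  · exact fun h => ⟨K, hK, S, hS, h, Or.inl ⟨rfl, rfl⟩⟩

theorem decompositionTree_not_adj_comp {V : Type} {𝒞 : Set (GraphIn V)} {𝒮 : Set (Set V)}
    {K K' : GraphIn V} : ¬ (decompositionTree 𝒞 𝒮).Adj (.comp K) (.comp K') := by
  rintro ⟨_, -, _, -, -, ⟨-, h⟩ | ⟨h, -⟩⟩ <;> cases h

theorem decompositionTree_not_adj_sep {V : Type} {𝒞 : Set (GraphIn V)} {𝒮 : Set (Set V)}
    {S S' : Set V} : ¬ (decompositionTree 𝒞 𝒮).Adj (.sep S) (.sep S') := by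
  rintro ⟨_, -, _, -, -, ⟨h, -⟩ | ⟨-, h⟩⟩ <;> cases h

/-- A family of decomposition trees can be maintained in DynFO if names of nodes, the property of
being a component, the vertices of nodes and the edges of components are first-order definable from
adjacency and avoiding reachability. -/
theorem treesInDynFO_of_foq {p k : ℕ} {T : TreeFamily p}
    (node comp : ∀ n, SimpleGraph (Fin n) → (Fin p → Fin n) → (Fin k → Fin n) → Prop)
    (mem : ∀ n, SimpleGraph (Fin n) → (Fin p → Fin n) → (Fin k → Fin n) → Fin n → Prop)
    (link : ∀ n, SimpleGraph (Fin n) → (Fin p → Fin n) → (Fin k → Fin n) → Fin n → Fin n → Prop)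
    (hnode : ∀ {α : Type} (f : Fin p → α) (g : Fin k → α),
      FOQ (fun n G (x : α → Fin n) => node n G (fun i => x (f i)) (fun j => x (g j))))
    (hcomp : ∀ {α : Type} (f : Fin p → α) (g : Fin k → α),
      FOQ (fun n G (x : α → Fin n) => comp n G (fun i => x (f i)) (fun j => x (g j))))
    (hmem : ∀ {α : Type} (f : Fin p → α) (g : Fin k → α) (a : α),
      FOQ (fun n G (x : α → Fin n) => mem n G (fun i => x (f i)) (fun j => x (g j)) (x a)))
    (hlink : ∀ {α : Type} (f : Fin p → α) (g : Fin k → α) (a b : α), FOQ (fun n G (x : α → Fin n) =>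
      link n G (fun i => x (f i)) (fun j => x (g j)) (x a) (x b)))
    (hname : ∀ n G c x, node n G c x → ∃ t, T G c t)
    (htree : ∀ n (G : SimpleGraph (Fin n)) c t, T G c t → ∃ 𝒞 𝒮, t = decompositionTree 𝒞 𝒮 ∧
      (∀ K ∈ 𝒞, ∀ K' ∈ 𝒞, K.verts = K'.verts → K = K') ∧ ∃ ν : (Fin k → Fin n) → DecNode (Fin n),
        ν '' {x | node n G c x} = DecNode.comp '' 𝒞 ∪ DecNode.sep '' 𝒮 ∧
        ∀ x, node n G c x → (comp n G c x ↔ (ν x).IsComp) ∧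
          (∀ v, mem n G c x v ↔ v ∈ (ν x).verts) ∧
          ∀ u v, link n G c x u v ↔ (ν x).Link u v) :
    TreesInDynFO T := by
  let C : TreeCode p k :=
    { node := fun n G => {w | node n G (fun i => w (Fin.castAdd k i)) fun j => w (Fin.natAdd p j)}
      isComp := fun n G =>
        {w | comp n G (fun i => w (Fin.castAdd k i)) fun j => w (Fin.natAdd p j)}
      -- A node is determined by its kind and its vertex set; for components this is the injectivity
      -- required in `htree`. Adjacency below is inclusion of a separating set in a component.
      same := fun n G => {w |
        (comp n G (fun i => w (Fin.castAdd (k + k) i))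
            (fun j => w (Fin.natAdd p (Fin.castAdd k j))) ↔
          comp n G (fun i => w (Fin.castAdd (k + k) i))
            (fun j => w (Fin.natAdd p (Fin.natAdd k j)))) ∧
        ∀ v, mem n G (fun i => w (Fin.castAdd (k + k) i))
            (fun j => w (Fin.natAdd p (Fin.castAdd k j))) v ↔
          mem n G (fun i => w (Fin.castAdd (k + k) i))
            (fun j => w (Fin.natAdd p (Fin.natAdd k j))) v}
      adj := fun n G => {w |
        ((comp n G (fun i => w (Fin.castAdd (k + k) i))
              (fun j => w (Fin.natAdd p (Fin.castAdd k j))) ∧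
            ¬ comp n G (fun i => w (Fin.castAdd (k + k) i))
              (fun j => w (Fin.natAdd p (Fin.natAdd k j)))) ∧
          ∀ v, mem n G (fun i => w (Fin.castAdd (k + k) i))
              (fun j => w (Fin.natAdd p (Fin.natAdd k j))) v →
            mem n G (fun i => w (Fin.castAdd (k + k) i))
              (fun j => w (Fin.natAdd p (Fin.castAdd k j))) v) ∨
        ((comp n G (fun i => w (Fin.castAdd (k + k) i))
              (fun j => w (Fin.natAdd p (Fin.natAdd k j))) ∧
            ¬ comp n G (fun i => w (Fin.castAdd (k + k) i))
              (fun j => w (Fin.natAdd p (Fin.castAdd k j)))) ∧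
          ∀ v, mem n G (fun i => w (Fin.castAdd (k + k) i))
              (fun j => w (Fin.natAdd p (Fin.castAdd k j))) v →
            mem n G (fun i => w (Fin.castAdd (k + k) i))
              (fun j => w (Fin.natAdd p (Fin.natAdd k j))) v)}
      mem := fun n G => {w | mem n G (fun i => w (Fin.castAdd (k + 1) i))
        (fun j => w (Fin.natAdd p (Fin.castAdd 1 j))) (w (Fin.natAdd p (Fin.natAdd k 0)))}
      link := fun n G => {w | link n G (fun i => w (Fin.castAdd (k + 2) i))
        (fun j => w (Fin.natAdd p (Fin.castAdd 2 j))) (w (Fin.natAdd p (Fin.natAdd k 0)))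
          (w (Fin.natAdd p (Fin.natAdd k 1)))} }
  refine ⟨k, C, ⟨FOQ.inDynFO (hnode _ _), FOQ.inDynFO (hcomp _ _),
    FOQ.inDynFO (((hcomp _ _).iff (hcomp _ _)).and (FOQ.all ((hmem (fun i => some _)
      (fun j => some _) none).iff (hmem (fun i => some _) (fun j => some _) none)))),
    FOQ.inDynFO ((((hcomp _ _).and (hcomp _ _).not).and (FOQ.all ((hmem (fun i => some _)
      (fun j => some _) none).imp (hmem (fun i => some _) (fun j => some _) none)))).or
      (((hcomp _ _).and (hcomp _ _).not).and (FOQ.all ((hmem (fun i => some _)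
      (fun j => some _) none).imp (hmem (fun i => some _) (fun j => some _) none))))),
    FOQ.inDynFO (hmem _ _ _), FOQ.inDynFO (hlink _ _ _ _)⟩, fun n G c => ⟨fun t ht => ?_, ?_⟩⟩
  swap
  · rintro ⟨x, hx⟩
    simp only [C, Set.mem_ofPred_eq, Fin.append_left, Fin.append_right] at hx
    exact hname n G c x hx
  obtain ⟨𝒞, 𝒮, rfl, hinj, ν, himg, hν⟩ := htree n G c t ht
  have hcase : ∀ x, node n G c x → (∃ K ∈ 𝒞, ν x = .comp K) ∨ ∃ S ∈ 𝒮, ν x = .sep S := by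
    intro x hx
    have h : ν x ∈ DecNode.comp '' 𝒞 ∪ DecNode.sep '' 𝒮 := himg ▸ Set.mem_image_of_mem ν hx
    rcases h with ⟨K, hK, h⟩ | ⟨S, hS, h⟩
    · exact Or.inl ⟨K, hK, h.symm⟩
    · exact Or.inr ⟨S, hS, h.symm⟩
  refine ⟨ν, ?_, fun x hx => ?_⟩
  · simp only [C, Set.mem_ofPred_eq, Fin.append_left, Fin.append_right]
    exact himg
  simp only [C, Set.mem_ofPred_eq, Fin.append_left, Fin.append_right, Matrix.cons_val_zero,
    Matrix.cons_val_one] at hx ⊢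
  obtain ⟨h1, h2, h3⟩ := hν x hx
  refine ⟨h1, h2, h3, fun y hy => ?_⟩
  obtain ⟨h1', h2', -⟩ := hν y hy
  have e1 : ∀ {z}, comp n G (fun i => c i) (fun j => z j) ↔ comp n G c z := Iff.rfl
  have e2 : ∀ {z v}, mem n G (fun i => c i) (fun j => z j) v ↔ mem n G c z v := Iff.rfl
  simp only [e1, e2, h1, h1', h2, h2']
  rcases hcase x hx with ⟨K, hK, hx'⟩ | ⟨S, hS, hx'⟩ <;>
    rcases hcase y hy with ⟨K', hK', hy'⟩ | ⟨S', hS', hy'⟩ <;>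
    simp only [hx', hy', DecNode.IsComp, DecNode.verts, iff_true, iff_false, false_iff,
      not_true, not_false_eq_true, true_and, and_true, false_and, and_false, or_false, false_or,
      reduceCtorEq, DecNode.comp.injEq, DecNode.sep.injEq]
  · exact ⟨⟨fun h => hinj K hK K' hK' (Set.ext h), fun h => by simp [h]⟩,
      decompositionTree_not_adj_comp⟩
  · exact (decompositionTree_adj_comp_sep hK hS').symm
  · rw [SimpleGraph.Subgraph.adj_comm]
    exact (decompositionTree_adj_comp_sep hK' hS).symm
  · exact ⟨Set.ext_iff.symm, decompositionTree_not_adj_sep⟩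

end Storing

/-! ### Biconnected component trees -/

section BiTrees

variable {n : ℕ} {G : SimpleGraph (Fin n)}

/-- `ab` is an edge or `a = b` is an isolated vertex. -/
def NamesBlock (G : SimpleGraph (Fin n)) (a b : Fin n) : Prop :=
  G.Adj a b ∨ a = b ∧ ∀ w, ¬ G.Adj a w

/-- `a` is a cut vertex of its connected component. -/
def IsCut (G : SimpleGraph (Fin n)) (a : Fin n) : Prop :=
  ∃ y z, G.Reachable a y ∧ y ≠ a ∧ z ≠ a ∧ G.Reachable a z ∧ ¬ WalkIn G {a}ᶜ y z

theorem mem_supp_mk_iff {V : Type} {G : SimpleGraph V} {c v : V} :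
    v ∈ (G.connectedComponentMk c).supp ↔ G.Reachable c v := by
  rw [SimpleGraph.ConnectedComponent.mem_supp_iff, SimpleGraph.ConnectedComponent.eq]
  exact ⟨fun h => h.symm, fun h => h.symm⟩

/-- A walk that starts in a connected component stays in it, so the restriction to the component can
be dropped and the condition no longer depends on `c`. -/
theorem isCutVertexOn_supp_iff {c v : Fin n} :
    IsCutVertexOn G (G.connectedComponentMk c).supp v ↔ G.Reachable c v ∧ IsCut G v := by
  rw [IsCutVertexOn, mem_supp_mk_iff]
  refine and_congr_right fun hv => ?_
  rw [connOn_iff]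
  push Not
  constructor
  · rintro ⟨y, ⟨hy, hyv⟩, z, ⟨hz, hzv⟩, h⟩
    rw [mem_supp_mk_iff] at hy hz
    refine ⟨y, z, hv.symm.trans hy, hyv, hzv, hv.symm.trans hz, fun h' => h ?_⟩
    refine h'.restrict.mono fun w hw => ⟨?_, fun e => WalkIn.right_mem hw e⟩
    rw [mem_supp_mk_iff]
    exact hy.trans (WalkIn.univ_iff.1 (WalkIn.mono hw (Set.subset_univ _)))
  · rintro ⟨y, z, hy, hyv, hzv, hz, h⟩
    refine ⟨y, ⟨mem_supp_mk_iff.2 (hv.trans hy), hyv⟩, z, ⟨mem_supp_mk_iff.2 (hv.trans hz), hzv⟩,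
      fun h' => h (h'.mono fun _ h => h.2)⟩

theorem IsCut.exists_adj {a : Fin n} (h : IsCut G a) : ∃ w, G.Adj a w := by
  obtain ⟨y, -, hy, hya, -⟩ := h
  obtain ⟨w, hw, -⟩ := (WalkIn.univ_iff.2 hy.symm).exists_adj_end hya
  exact ⟨w, hw.symm⟩

theorem NamesBlock.isBiconnComp {a b : Fin n} (h : NamesBlock G a b) :
    IsBiconnComp G Set.univ (block G a b) :=
  (isBiconnComp_univ_iff left_mem_block).2 ⟨a, b, h, rfl⟩

/-- A component is named by the ends of any of its edges, or by `(a, a)` if it is an isolated vertex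
`a`; a cut vertex `v` is named by `(v, v)`. -/
theorem biTrees_inDynFO : TreesInDynFO biTrees := by
  classical
  refine treesInDynFO_of_foq (k := 2)
    (fun n G c x => G.Reachable (c 0) (x 0) ∧
      (NamesBlock G (x 0) (x 1) ∨ x 0 = x 1 ∧ IsCut G (x 0)))
    (fun n G _ x => NamesBlock G (x 0) (x 1))
    (fun n G _ x v => NamesBlock G (x 0) (x 1) ∧ v ∈ block G (x 0) (x 1) ∨
      ¬ NamesBlock G (x 0) (x 1) ∧ v = x 0)
    (fun n G _ x u v => NamesBlock G (x 0) (x 1) ∧ u ∈ block G (x 0) (x 1) ∧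
      v ∈ block G (x 0) (x 1) ∧ G.Adj u v) ?_ ?_ ?_ ?_ ?_ ?_
  · have hb : ∀ {α : Type} (a b : α), FOQ (fun n G (x : α → Fin n) => NamesBlock G (x a) (x b)) :=
      fun a b => (FOQ.adj _ _).or ((FOQ.eq _ _).and (FOQ.isolated _))
    intro α f g
    exact (FOQ.reachable _ _).and ((hb _ _).or ((FOQ.eq _ _).and (FOQ.ex (FOQ.ex
      ((FOQ.reachable _ _).and ((FOQ.ne _ _).and ((FOQ.ne _ _).and ((FOQ.reachable _ _).and
        (FOQ.avoid_one _ _ _).not))))))))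
  · exact fun f g => (FOQ.adj _ _).or ((FOQ.eq _ _).and (FOQ.isolated _))
  · intro α f g a
    have hb : FOQ (fun n G (x : α → Fin n) => NamesBlock G (x (g 0)) (x (g 1))) :=
      (FOQ.adj _ _).or ((FOQ.eq _ _).and (FOQ.isolated _))
    exact (hb.and (FOQ.mem_block _ _ _)).or (hb.not.and (FOQ.eq _ _))
  · intro α f g a b
    exact ((FOQ.adj _ _).or ((FOQ.eq _ _).and (FOQ.isolated _))).and ((FOQ.mem_block _ _ _).and
      ((FOQ.mem_block _ _ _).and (FOQ.adj _ _)))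
  · exact fun n G c x _ => ⟨_, rfl⟩
  rintro n G c t rfl
  refine ⟨_, _, rfl, ?_, fun x => if NamesBlock G (x 0) (x 1) then
    .comp (inducedGraph G (block G (x 0) (x 1))) else .sep {x 0}, ?_, fun x hx => ?_⟩
  · rintro _ ⟨U, -, rfl⟩ _ ⟨U', -, rfl⟩ (h : U = U')
    rw [h]
  · ext d
    constructor
    · rintro ⟨x, ⟨hcx, hx⟩, rfl⟩
      by_cases hb : NamesBlock G (x 0) (x 1)
      · simp only [hb, if_true]
        refine Or.inl ⟨_, ⟨_, isBiconnComp_supp_iff.2 ⟨hb.isBiconnComp, ⟨_, left_mem_block⟩,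
          fun w hw => mem_supp_mk_iff.2 (hcx.trans ?_)⟩, rfl⟩, rfl⟩
        exact WalkIn.univ_iff.1 ((connOn_iff.1 hb.isBiconnComp.prop.2.1 _ left_mem_block w hw).mono
          (Set.subset_univ _))
      · simp only [hb, if_false]
        exact Or.inr ⟨_, ⟨_, isCutVertexOn_supp_iff.2 ⟨hcx, (hx.resolve_left hb).2⟩, rfl⟩, rfl⟩
    · rintro (⟨K, ⟨U, hU, rfl⟩, rfl⟩ | ⟨S, ⟨v, hv, rfl⟩, rfl⟩)
      · obtain ⟨hU, ⟨u, hu⟩, hsub⟩ := isBiconnComp_supp_iff.1 hU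
        obtain ⟨a, b, hab, rfl⟩ := (isBiconnComp_univ_iff hu).1 hU
        have hab' : NamesBlock G a b := hab
        refine ⟨![a, b], ⟨mem_supp_mk_iff.1 (hsub left_mem_block), Or.inl hab'⟩, ?_⟩
        simp [hab']
      · rw [isCutVertexOn_supp_iff] at hv
        -- The two uses of diagonal names do not clash: a cut vertex has a neighbour and is not
        -- isolated.
        have hb : ¬ NamesBlock G v v := by
          rintro (h | ⟨-, h⟩)
          · exact h.ne rfl
          · obtain ⟨w, hw⟩ := hv.2.exists_adj
            exact h w hw
        refine ⟨![v, v], ⟨hv.1, Or.inr ⟨rfl, hv.2⟩⟩, ?_⟩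
        simp [hb]
  · by_cases hb : NamesBlock G (x 0) (x 1)
    · simp [hb, DecNode.IsComp, DecNode.verts, DecNode.Link, inducedGraph]
    · simp [hb, DecNode.IsComp, DecNode.verts, DecNode.Link]

end BiTrees

/-! ### Triconnected component trees -/

section TriTrees

/-- `ab` names a biconnected component. -/
def NamesBiconnComp {n : ℕ} (G : SimpleGraph (Fin n)) (a b : Fin n) : Prop :=
  a ≠ b ∧ Unseparated G a b ∨ a = b ∧ ∀ w, ¬ G.Adj a w

theorem namesBiconnComp_iff {n : ℕ} {G : SimpleGraph (Fin n)} {a b : Fin n} {B : Set (Fin n)} :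
    (IsBiconnComp G Set.univ B ∧ a ∈ B ∧ b ∈ B ∧ (a ≠ b ∨ B = {a})) ↔
      NamesBiconnComp G a b ∧ B = block G a b := by
  constructor
  · rintro ⟨hB, ha, hb, h⟩
    by_cases hab : a = b
    · subst hab
      obtain rfl := h.resolve_left (not_not.2 rfl)
      exact ⟨Or.inr ⟨rfl, isBiconnComp_univ_singleton_iff.1 hB⟩, block_self.symm⟩
    · obtain ⟨h1, h2⟩ := (isBiconnComp_univ_iff_of_ne ha hb hab).1 hB
      exact ⟨Or.inl ⟨hab, h1⟩, h2⟩
  · rintro ⟨⟨hab, h⟩ | ⟨rfl, h⟩, rfl⟩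
    · exact ⟨(isBiconnComp_univ_iff_of_ne left_mem_block right_mem_block hab).2 ⟨h, rfl⟩,
        left_mem_block, right_mem_block, Or.inl hab⟩
    · rw [block_self]
      exact ⟨isBiconnComp_univ_singleton_iff.2 h, rfl, rfl, Or.inr rfl⟩

/-- Nodes are named by 4-tuples. If the last entry equals the first, the first three entries span a
triconnected component; otherwise the first and the last entry form a separating pair, and the
middle entries are irrelevant. -/
theorem triTrees_inDynFO : TreesInDynFO triTrees := by
  classical
  refine treesInDynFO_of_foq (k := 4)
    (fun n G c x => NamesBiconnComp G (c 0) (c 1) ∧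
      (x 3 = x 0 ∧ NamesTriBlock G (block G (c 0) (c 1)) (x 0) (x 1) (x 2) ∨
        x 3 ≠ x 0 ∧ IsSepPair G (block G (c 0) (c 1)) (x 0) (x 3)))
    (fun n G _ x => x 3 = x 0)
    (fun n G c x v => x 3 = x 0 ∧ v ∈ triBlock G (block G (c 0) (c 1)) (x 0) (x 1) (x 2) ∨
      x 3 ≠ x 0 ∧ (v = x 0 ∨ v = x 3))
    (fun n G c x u v => x 3 = x 0 ∧ u ∈ triBlock G (block G (c 0) (c 1)) (x 0) (x 1) (x 2) ∧
      v ∈ triBlock G (block G (c 0) (c 1)) (x 0) (x 1) (x 2) ∧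
        (G.Adj u v ∨ IsSepPair G (block G (c 0) (c 1)) u v)) ?_ ?_ ?_ ?_ ?_ ?_
  · intro α f g
    exact (((FOQ.ne _ _).and (FOQ.unseparated _ _)).or ((FOQ.eq _ _).and (FOQ.isolated _))).and
      (((FOQ.eq _ _).and (FOQ.namesTriBlock _ _ _ _ _)).or
        ((FOQ.ne _ _).and (FOQ.isSepPair _ _ _ _)))
  · exact fun f g => FOQ.eq _ _
  · exact fun f g a => ((FOQ.eq _ _).and (FOQ.mem_triBlock _ _ _ _ _ _)).or
      ((FOQ.ne _ _).and ((FOQ.eq _ _).or (FOQ.eq _ _)))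
  · exact fun f g a b => (FOQ.eq _ _).and ((FOQ.mem_triBlock _ _ _ _ _ _).and
      ((FOQ.mem_triBlock _ _ _ _ _ _).and ((FOQ.adj _ _).or (FOQ.isSepPair _ _ _ _))))
  · rintro n G c x ⟨hc, -⟩
    obtain ⟨h1, h2, h3, h4⟩ := namesBiconnComp_iff.2 ⟨hc, rfl⟩
    exact ⟨_, _, h1, h2, h3, h4, rfl⟩
  rintro n G c t ⟨B, hB, hc₀, hc₁, hc, rfl⟩
  obtain ⟨hname, rfl⟩ := namesBiconnComp_iff.1 ⟨hB, hc₀, hc₁, hc⟩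
  set B := block G (c 0) (c 1) with hBdef
  refine ⟨_, _, rfl, ?_, fun x => if x 3 = x 0 then
    .comp (triconnGraph G B (triBlock G B (x 0) (x 1) (x 2))) else .sep {x 0, x 3}, ?_,
    fun x hx => ?_⟩
  · rintro _ ⟨U, -, rfl⟩ _ ⟨U', -, rfl⟩ (h : U = U')
    rw [h]
  · ext d
    constructor
    · rintro ⟨x, ⟨-, ⟨h, hx⟩ | ⟨h, hx⟩⟩, rfl⟩
      · simp only [h, if_true]
        exact Or.inl ⟨_, ⟨_, (hB.isTriconnComp_iff ⟨_, hc₀⟩).2 ⟨_, _, _, hx, rfl⟩, rfl⟩, rfl⟩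
      · simp only [h, if_false]
        exact Or.inr ⟨_, ⟨_, _, hB.isThreeConnSepPair_iff.2 hx, rfl⟩, rfl⟩
    · rintro (⟨K, ⟨U, hU, rfl⟩, rfl⟩ | ⟨S, ⟨u, v, huv, rfl⟩, rfl⟩)
      · obtain ⟨x, y, z, hx, rfl⟩ := (hB.isTriconnComp_iff ⟨_, hc₀⟩).1 hU
        exact ⟨![x, y, z, x], ⟨hname, Or.inl ⟨rfl, hx⟩⟩, if_pos rfl⟩
      · have hne : v ≠ u := huv.2.2.1.symm
        exact ⟨![u, u, u, v], ⟨hname, Or.inr ⟨hne, hB.isThreeConnSepPair_iff.1 huv⟩⟩, if_neg hne⟩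
  · by_cases h : x 3 = x 0
    · simp [h, DecNode.IsComp, DecNode.verts, DecNode.Link, triconnGraph,
        hB.isThreeConnSepPair_iff]
    · simp [h, DecNode.IsComp, DecNode.verts, DecNode.Link]

end TriTrees

theorem mainTheorem12 : TreesInDynFO biTrees ∧ TreesInDynFO triTrees :=
  ⟨biTrees_inDynFO, triTrees_inDynFO⟩
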